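/- **Setting.** Two base stations (BS 1, BS 2) with transmit powers $P_1,P_2>0$ offload data to a macro BS. Let $C(x)=\log_2(1+x)$. In time slot $i=1,2,\dots$ the squared channel gains are $\mathbf s=(s_0,s_1,s_2)\in[0,\infty)^3$ (links BS 1–BS 2, BS 1–macro BS, BS 2–macro BS). The vector process of gains is stationary and ergodic; the three component processes are independent, and each gain has a finite mean and a density. A *policy* consists of measurable functions of $\mathbf s$: a mode selection $q_k(\mathbf s)\in\{0,1\}$, $\sum_{k=1}^3q_k(\mathbf s)=1$, and power fractions in $[0,1]$ with $\alpha^{(1)}_1+\alpha^{(1)}_2=\beta^{(2)}_1+\beta^{(2)}_2=\sum_{j=1}^3\alpha^{(3)}_j=\sum_{j=1}^3\beta^{(3)}_j=1$. Put $$C_{12}^{\mathrm c}=C\Big(\tfrac{\alpha^{(1)}_1P_1s_0}{1+\alpha^{(1)}_2P_1s_0}\Big),\quad C_{1d}^{\mathrm c}=C\Big(\tfrac{\alpha^{(1)}_1P_1s_1}{1+\alpha^{(1)}_2P_1s_1}\Big),\quad C_{1d}^{\mathrm{nc}}=C(\alpha^{(1)}_2P_1s_1),$$ $$C_{21}^{\mathrm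 c}=C\Big(\tfrac{\beta^{(2)}_1P_2s_0}{1+\beta^{(2)}_2P_2s_0}\Big),\quad C_{2d}^{\mathrm c}=C\Big(\tfrac{\beta^{(2)}_1P_2s_2}{1+\beta^{(2)}_2P_2s_2}\Big),\quad C_{2d}^{\mathrm{nc}}=C(\beta^{(2)}_2P_2s_2),$$ $$C_{1r}^{\mathrm{nc}}=C(\alpha^{(3)}_3P_1s_1),\quad C_{2r}^{\mathrm{nc}}=C(\beta^{(3)}_3P_2s_2),\quad C_{\mathrm{sum}}^{\mathrm{nc}}=C(\alpha^{(3)}_3P_1s_1+\beta^{(3)}_3P_2s_2),$$ $$C_{\mathrm{sum}}^{\mathrm c}=C\Big(P_1s_1+P_2s_2+2\sqrt{(\alpha^{(3)}_1+\alpha^{(3)}_2)(\beta^{(3)}_1+\beta^{(3)}_2)P_1P_2s_1s_2}\Big),$$ and denote by a bar the averages $E\{q_k(\mathbf s)\,\cdot\,\}$, with $k=1$ for $C_{12}^{\mathrm c},C_{1d}^{\mathrm c},C_{1d}^{\mathrm{nc}}$, $k=2$ for $C_{21}^{\mathrm c},C_{2d}^{\mathrm c},C_{2d}^{\mathrm{nc}}$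 and $k=3$ for $C_{\mathrm{sum}}^{\mathrm c},C_{\mathrm{sum}}^{\mathrm{nc}}$. A *protocol* is a policy together with nonnegative rates, chosen causally in each slot from the gains up to that slot. Let $Q_1,Q_2$ be the contents of the infinite, initially empty, first-in first-out buffers of BS 1 and BS 2 at the end of the previous slot. The rates must satisfy the following; rates not mentioned are $0$. * Mode 1: $R_1^{\mathrm c}\le C_{12}^{\mathrm c}$, $R_1^{\mathrm{nc}}\le C_{1d}^{\mathrm{nc}}$, $T_1\le\min\{R_1^{\mathrm c},C_{1d}^{\mathrm c}\}$; then $Q_2$ grows by $R_1^{\mathrm c}-T_1$ (the partition index of the cooperative codeword). * Mode 2: the same with BS 1 and BS 2 exchanged ($C_{21}^{\mathrm c},C_{2d}^{\mathrm{nc}},C_{2d}^{\mathrm c}$; $Q_1$ grows by $R_2^{\mathrm c}-T_2$). * Mode 3: $R_j^{\mathrm{nc}}\le C_{jr}^{\mathrm{nc}}$ and $R_j^{\mathrm c}\le Q_j$ for $j=1,2$, $R_1^{\mathrm{nc}}+R_2^{\mathrm{nc}}\le C_{\mathrm{sum}}^{\mathrm{nc}}$, $R_1^{\mathrm{nc}}+R_2^{\mathrm{nc}}+R_1^{\mathrm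 c}+R_2^{\mathrm c}\le C_{\mathrm{sum}}^{\mathrm c}$; then $Q_j$ falls by $R_j^{\mathrm c}$. $\bar R^{\mathrm{nc}}_{\mathrm{sum}}$ is the almost sure limit, as $N\to\infty$, of $\frac1N\sum_{i\le N}(R_1^{\mathrm{nc}}+R_2^{\mathrm{nc}})$. $\bar R^{\mathrm c}_{\mathrm{sum}}$ is the almost sure limit of $\frac1N$ times the sum of the rates $R_1^{\mathrm c}$ (mode 1) and $R_2^{\mathrm c}$ (mode 2) over the slots $i\le N$ whose partition index has been completely delivered to the macro BS in mode-3 slots up to $N$ (an empty index counts as delivered). The sum rate is the almost sure limit of the sum of the two averages. A protocol is *optimal* if its sum rate exists and no protocol has a larger one. The virtual queue is *rate stable* if $(Q_1(N)+Q_2(N))/N\to0$ almost surely. **Lemma (Optimal Queue Condition).** 1. For every optimal protocol, the virtual queue is rate stable, and the average arrivals and departures of the virtual queue balance: $$\bar C_{\mathrm{sum}}^{\mathrm{nc}}+\bar C_{12}^{\mathrm c}+\bar C_{21}^{\mathrm c}=\bar C_{\mathrm{sum}}^{\mathrm c}+\bar C_{1d}^{\mathrm c}+\bar C_{2d}^{\mathrm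 c}.\qquad(\ast)$$ Moreover $\bar R^{\mathrm c}_{\mathrm{sum}}$ and $\bar R^{\mathrm{nc}}_{\mathrm{sum}}$ exist, and $$\bar R^{\mathrm c}_{\mathrm{sum}}=\bar C_{12}^{\mathrm c}+\bar C_{21}^{\mathrm c},\qquad \bar R^{\mathrm{nc}}_{\mathrm{sum}}=\bar C_{\mathrm{sum}}^{\mathrm{nc}}+\bar C_{1d}^{\mathrm{nc}}+\bar C_{2d}^{\mathrm{nc}}.\qquad(\ast\ast)$$ 2. For every policy that satisfies $(\ast)$ and for which, almost surely, $C_{1d}^{\mathrm c}(\mathbf s)\le C_{12}^{\mathrm c}(\mathbf s)$ when $q_1(\mathbf s)=1$ and $C_{2d}^{\mathrm c}(\mathbf s)\le C_{21}^{\mathrm c}(\mathbf s)$ when $q_2(\mathbf s)=1$, the maximum values of $\bar R^{\mathrm c}_{\mathrm{sum}}$ and of $\bar R^{\mathrm{nc}}_{\mathrm{sum}}$ over the protocols with this policy are those in $(\ast\ast)$, and one protocol with a rate stable virtual queue attains both. -/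

import Mathlib

open MeasureTheory ProbabilityTheory Filter Topology
open scoped NNReal

noncomputable section

namespace Backhaul

/-- A fading state `(s₀, s₁, s₂)` of squared channel gains: BS 1 -- BS 2, BS 1 -- macro BS,
BS 2 -- macro BS. -/
abbrev State := Fin 3 → ℝ≥0

/-- A realization of the fading process; slot number `i + 1` has fading state `x i`. -/
abbrev Path := ℕ → State

/-- `ν` is the law of the fading process: the vector process is stationary and ergodic, its three
component processes are independent, and every gain has a finite mean and a density. -/
structure IsFadingLaw (ν : Measure Path) : Prop where
  isProbabilityMeasure : IsProbabilityMeasure ν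
  ergodic : Ergodic (fun (x : Path) (i : ℕ) => x (i + 1)) ν
  independent : iIndepFun (fun (l : Fin 3) (x : Path) (i : ℕ) => x i l) ν
  finite_mean : ∀ l : Fin 3, Integrable (fun x : Path => (x 0 l : ℝ)) ν
  density : ∀ l : Fin 3, ν.map (fun x : Path => (x 0 l : ℝ)) ≪ (volume : Measure ℝ)

/-- `C(x) = log₂ (1 + x)`. -/
def C (x : ℝ) : ℝ := Real.logb 2 (1 + x)

/-- The three transmission modes: BS 1 broadcasts, BS 2 broadcasts, both transmit. -/
inductive Mode where
  | M1 | M2 | M3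
  deriving DecidableEq

/-- A mode selection and power sharing policy, as a function of the fading state.  The indices
of the power fractions start at zero. -/
structure Policy where
  mode : State → Mode
  /-- mode `M1`: fractions of `P₁` for the cooperative and the non-cooperative codeword -/
  α₁ : Fin 2 → State → ℝ
  /-- mode `M2`: fractions of `P₂` for the cooperative and the non-cooperative codeword -/
  β₂ : Fin 2 → State → ℝ
  /-- mode `M3`: fractions of `P₁` for `U₁`, `U₂`, `V₁` -/
  α₃ : Fin 3 → State → ℝ
  /-- mode `M3`: fractions of `P₂` for `U₂`, `U₁`, `V₂` -/
  β₃ : Fin 3 → State → ℝ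
  measurable_mode : ∀ m, MeasurableSet {s | mode s = m}
  measurable_α₁ : ∀ j, Measurable (α₁ j)
  measurable_β₂ : ∀ j, Measurable (β₂ j)
  measurable_α₃ : ∀ j, Measurable (α₃ j)
  measurable_β₃ : ∀ j, Measurable (β₃ j)
  α₁_mem : ∀ j s, α₁ j s ∈ Set.Icc (0 : ℝ) 1
  β₂_mem : ∀ j s, β₂ j s ∈ Set.Icc (0 : ℝ) 1
  α₃_mem : ∀ j s, α₃ j s ∈ Set.Icc (0 : ℝ) 1
  β₃_mem : ∀ j s, β₃ j s ∈ Set.Icc (0 : ℝ) 1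
  α₁_sum : ∀ s, ∑ j, α₁ j s = 1
  β₂_sum : ∀ s, ∑ j, β₂ j s = 1
  α₃_sum : ∀ s, ∑ j, α₃ j s = 1
  β₃_sum : ∀ s, ∑ j, β₃ j s = 1

namespace Policy

variable (π : Policy) (P₁ P₂ : ℝ) (s : State)

/-- The binary mode selection variable `q_k(s)`. -/
def q (m : Mode) : ℝ := if π.mode s = m then 1 else 0

/-! Instantaneous capacities. -/

def C12c : ℝ := C (π.α₁ 0 s * P₁ * s 0 / (1 + π.α₁ 1 s * P₁ * s 0))
def C1dc : ℝ := C (π.α₁ 0 s * P₁ * s 1 / (1 + π.α₁ 1 s * P₁ * s 1))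
def C1dnc : ℝ := C (π.α₁ 1 s * P₁ * s 1)
def C21c : ℝ := C (π.β₂ 0 s * P₂ * s 0 / (1 + π.β₂ 1 s * P₂ * s 0))
def C2dc : ℝ := C (π.β₂ 0 s * P₂ * s 2 / (1 + π.β₂ 1 s * P₂ * s 2))
def C2dnc : ℝ := C (π.β₂ 1 s * P₂ * s 2)
def C1rnc : ℝ := C (π.α₃ 2 s * P₁ * s 1)
def C2rnc : ℝ := C (π.β₃ 2 s * P₂ * s 2)
def Csumnc : ℝ := C (π.α₃ 2 s * P₁ * s 1 + π.β₃ 2 s * P₂ * s 2)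
def Csumc : ℝ :=
  C (P₁ * s 1 + P₂ * s 2 +
    2 * Real.sqrt ((π.α₃ 0 s + π.α₃ 1 s) * (π.β₃ 0 s + π.β₃ 1 s) * P₁ * P₂ * s 1 * s 2))

/-! Average capacities `E{q_k(s) C(s)}` under the law `ν` of the fading process. -/

variable (ν : Measure Path)

def avgC12c : ℝ := ∫ x, π.q (x 0) .M1 * π.C12c P₁ (x 0) ∂ν
def avgC1dc : ℝ := ∫ x, π.q (x 0) .M1 * π.C1dc P₁ (x 0) ∂ν
def avgC1dnc : ℝ := ∫ x, π.q (x 0) .M1 * π.C1dnc P₁ (x 0) ∂ν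
def avgC21c : ℝ := ∫ x, π.q (x 0) .M2 * π.C21c P₂ (x 0) ∂ν
def avgC2dc : ℝ := ∫ x, π.q (x 0) .M2 * π.C2dc P₂ (x 0) ∂ν
def avgC2dnc : ℝ := ∫ x, π.q (x 0) .M2 * π.C2dnc P₂ (x 0) ∂ν
def avgCsumc : ℝ := ∫ x, π.q (x 0) .M3 * π.Csumc P₁ P₂ (x 0) ∂ν
def avgCsumnc : ℝ := ∫ x, π.q (x 0) .M3 * π.Csumnc P₁ P₂ (x 0) ∂ν

/-- The balance of average arrivals and departures of the virtual queue. -/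
def QueueBalance : Prop :=
  π.avgCsumnc P₁ P₂ ν + π.avgC12c P₁ ν + π.avgC21c P₂ ν =
    π.avgCsumc P₁ P₂ ν + π.avgC1dc P₁ ν + π.avgC2dc P₂ ν

/-- In the broadcast modes, almost surely, the cooperative codeword rate between the BSs is at
least the part of it that the macro BS resolves directly. -/
def DirectLeExchange : Prop :=
  ∀ᵐ x ∂ν, (π.mode (x 0) = .M1 → π.C1dc P₁ (x 0) ≤ π.C12c P₁ (x 0)) ∧
    (π.mode (x 0) = .M2 → π.C2dc P₂ (x 0) ≤ π.C21c P₂ (x 0))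

end Policy

/-- The rates used in one slot: `cⱼ = R_j^c`, `ncⱼ = R_j^nc`, and the partition exponents `tⱼ = T_j`.
In mode `M3`, `cⱼ` is the rate of refinement information taken from buffer `B_j`. -/
structure SlotRates where
  c₁ : ℝ
  c₂ : ℝ
  nc₁ : ℝ
  nc₂ : ℝ
  t₁ : ℝ
  t₂ : ℝ

/-- The conditions for successful transmission in a slot with fading state `s`, when the buffers
hold the amounts `Q = (Q₁, Q₂)` at the end of the previous slot.  Rates that are not used in
the selected mode are zero. -/
def Admissible (π : Policy) (P₁ P₂ : ℝ) (s : State) (Q : ℝ × ℝ) (r : SlotRates) : Prop :=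
  (0 ≤ r.c₁ ∧ 0 ≤ r.c₂ ∧ 0 ≤ r.nc₁ ∧ 0 ≤ r.nc₂ ∧ 0 ≤ r.t₁ ∧ 0 ≤ r.t₂) ∧
  match π.mode s with
  | .M1 =>
      r.c₁ ≤ π.C12c P₁ s ∧ r.nc₁ ≤ π.C1dnc P₁ s ∧ r.t₁ ≤ min r.c₁ (π.C1dc P₁ s) ∧
        r.c₂ = 0 ∧ r.nc₂ = 0 ∧ r.t₂ = 0
  | .M2 =>
      r.c₂ ≤ π.C21c P₂ s ∧ r.nc₂ ≤ π.C2dnc P₂ s ∧ r.t₂ ≤ min r.c₂ (π.C2dc P₂ s) ∧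
        r.c₁ = 0 ∧ r.nc₁ = 0 ∧ r.t₁ = 0
  | .M3 =>
      r.nc₁ ≤ π.C1rnc P₁ s ∧ r.nc₂ ≤ π.C2rnc P₂ s ∧ r.c₁ ≤ Q.1 ∧ r.c₂ ≤ Q.2 ∧
        r.nc₁ + r.nc₂ ≤ π.Csumnc P₁ P₂ s ∧
        r.nc₁ + r.nc₂ + r.c₁ + r.c₂ ≤ π.Csumc P₁ P₂ s ∧ r.t₁ = 0 ∧ r.t₂ = 0

/-- Evolution of the buffer contents `(Q₁, Q₂)` during one slot. -/
def queueStep (m : Mode) (r : SlotRates) (Q : ℝ × ℝ) : ℝ × ℝ :=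
  match m with
  | .M1 => (Q.1, Q.2 + r.c₁ - r.t₁)
  | .M2 => (Q.1 + r.c₂ - r.t₂, Q.2)
  | .M3 => (Q.1 - r.c₁, Q.2 - r.c₂)

/-- Buffer contents after the first `N` slots, with both buffers empty at the beginning. -/
def queue (m : ℕ → Mode) (r : ℕ → SlotRates) : ℕ → ℝ × ℝ
  | 0 => (0, 0)
  | N + 1 => queueStep (m N) (r N) (queue m r N)

/-- A protocol: a policy, together with rates that are chosen in each slot causally, from the fading
states up to that slot, and that satisfy the conditions for successful transmission. -/
structure Protocol (P₁ P₂ : ℝ) where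
  policy : Policy
  rates : Path → ℕ → SlotRates
  causal : ∀ (x y : Path) (i : ℕ), (∀ k ≤ i, x k = y k) → rates x i = rates y i
  admissible : ∀ (x : Path) (i : ℕ),
    Admissible policy P₁ P₂ (x i) (queue (fun k => policy.mode (x k)) (rates x) i) (rates x i)

namespace Protocol

variable {P₁ P₂ : ℝ} (σ : Protocol P₁ P₂) (x : Path)

/-- The mode used in a slot. -/
def mode (i : ℕ) : Mode := σ.policy.mode (x i)

/-- Total content of the two buffers (the virtual queue) after `N` slots. -/
def virtualQueue (N : ℕ) : ℝ :=
  (queue (σ.mode x) (σ.rates x) N).1 + (queue (σ.mode x) (σ.rates x) N).2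

/-- Amount entering buffer `B₁` in a slot: the partition index of the codeword of BS 2. -/
def arrival₁ (i : ℕ) : ℝ :=
  if σ.mode x i = .M2 then (σ.rates x i).c₂ - (σ.rates x i).t₂ else 0

/-- Amount entering buffer `B₂` in a slot: the partition index of the codeword of BS 1. -/
def arrival₂ (i : ℕ) : ℝ :=
  if σ.mode x i = .M1 then (σ.rates x i).c₁ - (σ.rates x i).t₁ else 0

/-- Amount leaving buffer `B₁` in a slot. -/
def departure₁ (i : ℕ) : ℝ := if σ.mode x i = .M3 then (σ.rates x i).c₁ else 0

/-- Amount leaving buffer `B₂` in a slot. -/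
def departure₂ (i : ℕ) : ℝ := if σ.mode x i = .M3 then (σ.rates x i).c₂ else 0

/-- After `N` slots the macro BS has the whole partition index stored in slot `i` in a first-in
first-out buffer with the given arrivals and departures. -/
def IndexReceived (arrival departure : ℕ → ℝ) (i N : ℕ) : Prop :=
  arrival i = 0 ∨ ∑ k ∈ Finset.range (i + 1), arrival k ≤ ∑ k ∈ Finset.range N, departure k

open Classical in
/-- Cooperative information sent in slot `i` that the macro BS has decoded after `N` slots. -/
def coopDecoded (N i : ℕ) : ℝ :=
  match σ.mode x i with
  | .M1 => if IndexReceived (σ.arrival₂ x) (σ.departure₂ x) i N then (σ.rates x i).c₁ else 0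
  | .M2 => if IndexReceived (σ.arrival₁ x) (σ.departure₁ x) i N then (σ.rates x i).c₂ else 0
  | .M3 => 0

/-- Average sum rate with BS cooperation over the first `N` slots. -/
def coopAvg (N : ℕ) : ℝ := (∑ i ∈ Finset.range N, σ.coopDecoded x N i) / N

/-- Average sum rate without BS cooperation over the first `N` slots. -/
def noncoopAvg (N : ℕ) : ℝ :=
  (∑ i ∈ Finset.range N, ((σ.rates x i).nc₁ + (σ.rates x i).nc₂)) / N

variable (ν : Measure Path)

/-- `R̄_sum^c = R`: almost surely, as `N → ∞`. -/
def HasCoopRate (R : ℝ) : Prop := ∀ᵐ x ∂ν, Tendsto (fun N => σ.coopAvg x N) atTop (𝓝 R)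

/-- `R̄_sum^nc = R`: almost surely, as `N → ∞`. -/
def HasNoncoopRate (R : ℝ) : Prop := ∀ᵐ x ∂ν, Tendsto (fun N => σ.noncoopAvg x N) atTop (𝓝 R)

/-- The average sum rate (with plus without BS cooperation) is `R`: almost surely, as `N → ∞`. -/
def HasSumRate (R : ℝ) : Prop :=
  ∀ᵐ x ∂ν, Tendsto (fun N => σ.coopAvg x N + σ.noncoopAvg x N) atTop (𝓝 R)

/-- The virtual queue is rate stable. -/
def RateStable : Prop :=
  ∀ᵐ x ∂ν, Tendsto (fun N : ℕ => σ.virtualQueue x N / N) atTop (𝓝 0)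

/-- The protocol attains the maximum average sum rate. -/
def IsOptimal : Prop :=
  ∃ R, σ.HasSumRate ν R ∧ ∀ (σ' : Protocol P₁ P₂) (R' : ℝ), σ'.HasSumRate ν R' → R' ≤ R

end Protocol

end Backhaul

end

namespace Backhaul

/-! ### The pointwise ergodic theorem for an ergodic transformation -/

section Birkhoff

variable {α : Type*}

/-- The maximum of `0` and of the first `n` nonempty Birkhoff sums of `f`. -/
def maxBirkhoffSum (T : α → α) (f : α → ℝ) : ℕ → α → ℝ
  | 0 => 0
  | n + 1 => fun x => max 0 (f x + maxBirkhoffSum T f n (T x))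

theorem maxBirkhoffSum_nonneg (T : α → α) (f : α → ℝ) (n : ℕ) (x : α) :
    0 ≤ maxBirkhoffSum T f n x := by
  cases n with
  | zero => exact le_rfl
  | succ n => exact le_max_left _ _

theorem maxBirkhoffSum_le_succ (T : α → α) (f : α → ℝ) (n : ℕ) :
    ∀ x, maxBirkhoffSum T f n x ≤ maxBirkhoffSum T f (n + 1) x := by
  induction n with
  | zero => intro x; exact le_max_left _ _
  | succ n ih =>
    intro x
    exact max_le_max le_rfl (by linarith [ih (T x)])

theorem birkhoffSum_le_maxBirkhoffSum (T : α → α) (f : α → ℝ) (n : ℕ) :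
    ∀ x, birkhoffSum T f n x ≤ maxBirkhoffSum T f n x := by
  induction n with
  | zero => intro x; simp [maxBirkhoffSum]
  | succ n ih =>
    intro x
    rw [birkhoffSum_succ']
    exact le_max_of_le_right (by linarith [ih (T x)])

variable [MeasurableSpace α] {μ : Measure α} {T : α → α} {f : α → ℝ}

theorem measurable_maxBirkhoffSum (hT : Measurable T) (hf : Measurable f) (n : ℕ) :
    Measurable (maxBirkhoffSum T f n) := by
  induction n with
  | zero => exact measurable_const
  | succ n ih => exact measurable_const.max (hf.add (ih.comp hT))

theorem integrable_maxBirkhoffSum (hT : MeasurePreserving T μ μ) (hf : Integrable f μ) (n : ℕ) :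
    Integrable (maxBirkhoffSum T f n) μ := by
  induction n with
  | zero => exact integrable_zero _ _ _
  | succ n ih =>
    exact (integrable_zero α ℝ μ).sup (hf.add (hT.integrable_comp_of_integrable ih))

theorem ae_bddAbove_birkhoffSum (hT : Ergodic T μ) (hfm : Measurable f) (hf : Integrable f μ)
    (hneg : ∫ x, f x ∂μ < 0) :
    ∀ᵐ x ∂μ, BddAbove (Set.range fun n => birkhoffSum T f n x) := by
  have hTp := hT.toMeasurePreserving
  set M := maxBirkhoffSum T f with hM
  have hMm : ∀ n, Measurable (M n) := measurable_maxBirkhoffSum hTp.measurable hfm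
  have hMi : ∀ n, Integrable (M n) μ := integrable_maxBirkhoffSum hTp hf
  have hM0 : ∀ n x, 0 ≤ M n x := maxBirkhoffSum_nonneg T f
  have hMs : ∀ n x, M (n + 1) x = max 0 (f x + M n (T x)) := fun _ _ => rfl
  have hMmono : ∀ x, Monotone fun n => M n x := fun x =>
    monotone_nat_of_le_succ fun n => maxBirkhoffSum_le_succ T f n x
  set A := {x | BddAbove (Set.range fun n => M n x)} with hA
  have hAm : MeasurableSet A := measurableSet_bddAbove_range hMm
  have hAinv : T ⁻¹' A = A := by
    ext x
    constructor
    · rintro ⟨K, hK⟩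
      refine ⟨max 0 (f x + K), ?_⟩
      rintro _ ⟨n, rfl⟩
      refine (hMmono x n.le_succ).trans ?_
      simp only [Nat.succ_eq_add_one, hMs]
      exact max_le_max le_rfl (by linarith [hK ⟨n, rfl⟩])
    · rintro ⟨K, hK⟩
      refine ⟨K - f x, ?_⟩
      rintro _ ⟨n, rfl⟩
      have h1 : M (n + 1) x ≤ K := hK ⟨n + 1, rfl⟩
      rw [hMs] at h1
      have h2 := (le_max_right _ _).trans h1
      simp only
      linarith
  have hle : ∀ x, x ∈ A → BddAbove (Set.range fun n => birkhoffSum T f n x) := by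
    rintro x ⟨K, hK⟩
    refine ⟨K, ?_⟩
    rintro _ ⟨n, rfl⟩
    exact (birkhoffSum_le_maxBirkhoffSum T f n x).trans (hK ⟨n, rfl⟩)
  rcases hT.toPreErgodic.ae_mem_or_ae_notMem hAm hAinv with h | h
  · exact h.mono hle
  · exfalso
    have hpos : ∀ n, 0 ≤ ∫ x, max (-M n (T x)) (f x) ∂μ := by
      intro n
      have h1 : ∀ x, max (-M n (T x)) (f x) = M (n + 1) x - M n (T x) := by
        intro x
        rw [hMs, max_sub_sub_right 0 (f x + M n (T x)) (M n (T x))|>.symm]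
        simp
      simp_rw [h1]
      have hMT : Integrable (fun x => M n (T x)) μ := hTp.integrable_comp_of_integrable (hMi n)
      rw [integral_sub (hMi _) hMT]
      have h2 : ∫ x, M n (T x) ∂μ = ∫ x, M n x ∂μ := by
        conv_rhs => rw [← hTp.map_eq]
        rw [integral_map hTp.aemeasurable (hMm n).aestronglyMeasurable]
      rw [h2]
      have := integral_mono (hMi n) (hMi (n + 1)) (maxBirkhoffSum_le_succ T f n)
      linarith
    have hlim : Tendsto (fun n => ∫ x, max (-M n (T x)) (f x) ∂μ) atTop (𝓝 (∫ x, f x ∂μ)) := by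
      refine tendsto_integral_of_dominated_convergence (fun x => |f x|) ?_ hf.abs ?_ ?_
      · intro n
        exact (((hMm n).comp hTp.measurable).neg.max hfm).aestronglyMeasurable
      · intro n
        refine Eventually.of_forall fun x => ?_
        rw [Real.norm_eq_abs, abs_le]
        exact ⟨(neg_abs_le _).trans (le_max_right _ _),
          max_le (by linarith [hM0 n (T x), abs_nonneg (f x)]) (le_abs_self _)⟩
      · filter_upwards [h] with x hx
        have hx' : ¬ BddAbove (Set.range fun n => M n (T x)) := by
          intro hb
          exact hx (hAinv ▸ (show x ∈ T ⁻¹' A from hb))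
        have ht : Tendsto (fun n => M n (T x)) atTop atTop := by
          rcases tendsto_atTop_of_monotone (hMmono (T x)) with h | ⟨l, hl⟩
          · exact h
          · exact absurd hl.bddAbove_range hx'
        refine tendsto_const_nhds.congr' ?_
        filter_upwards [ht.eventually_ge_atTop (-f x)] with n hn
        exact (max_eq_right (by linarith)).symm
    exact absurd (ge_of_tendsto' hlim hpos) (not_le.2 hneg)

theorem ae_eventually_birkhoffSum_le [IsProbabilityMeasure μ] (hT : Ergodic T μ)
    (hfm : Measurable f) (hf : Integrable f μ) :
    ∀ᵐ x ∂μ, ∀ ε > 0, ∀ᶠ n : ℕ in atTop,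
      birkhoffSum T f n x / n ≤ ∫ x, f x ∂μ + ε := by
  have key : ∀ k : ℕ, ∀ᵐ x ∂μ, BddAbove (Set.range fun n =>
      birkhoffSum T (fun y => f y - (∫ x, f x ∂μ + 1 / ((k : ℝ) + 1))) n x) := by
    intro k
    have hk : (0 : ℝ) < 1 / ((k : ℝ) + 1) := by positivity
    refine ae_bddAbove_birkhoffSum hT (hfm.sub_const _) (hf.sub (integrable_const _)) ?_
    rw [integral_sub hf (integrable_const _)]
    simp
    positivity
  filter_upwards [ae_all_iff.2 key] with x hx ε hε
  obtain ⟨k, hk⟩ := exists_nat_one_div_lt (half_pos hε)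
  obtain ⟨K, hK⟩ := hx k
  have h0 : Tendsto (fun n : ℕ => K / (n : ℝ)) atTop (𝓝 0) :=
    tendsto_const_nhds.div_atTop tendsto_natCast_atTop_atTop
  filter_upwards [h0.eventually_le_const (half_pos hε), eventually_gt_atTop 0] with n hn hn0
  have hn0' : (0 : ℝ) < n := by exact_mod_cast hn0
  have h1 := hK ⟨n, rfl⟩
  simp only [birkhoffSum, Finset.sum_sub_distrib, Finset.sum_const, Finset.card_range,
    nsmul_eq_mul] at h1
  rw [div_le_iff₀ hn0'] at hn ⊢
  have h2 : (n : ℝ) * (1 / ((k : ℝ) + 1)) ≤ n * (ε / 2) := by gcongr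
  simp only [birkhoffSum]
  nlinarith

/-- The pointwise ergodic theorem: time averages converge almost surely to the expectation. -/
theorem ae_tendsto_birkhoffSum_div [IsProbabilityMeasure μ] (hT : Ergodic T μ)
    (hfm : Measurable f) (hf : Integrable f μ) :
    ∀ᵐ x ∂μ, Tendsto (fun n : ℕ => birkhoffSum T f n x / n) atTop (𝓝 (∫ x, f x ∂μ)) := by
  filter_upwards [ae_eventually_birkhoffSum_le hT hfm hf,
    ae_eventually_birkhoffSum_le hT hfm.neg hf.neg] with x h1 h2
  rw [tendsto_order]
  constructor
  · intro a ha
    filter_upwards [h2 ((∫ x, f x ∂μ - a) / 2) (by linarith)] with n hn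
    rw [birkhoffSum_neg, neg_div] at hn
    simp only [Pi.neg_apply, integral_neg] at hn
    linarith
  · intro a ha
    filter_upwards [h1 ((a - ∫ x, f x ∂μ) / 2) (by linarith)] with n hn
    linarith

end Birkhoff

/-! ### Cesàro asymptotics of queues -/

theorem tendsto_comp_div_zero {Y : ℕ → ℝ} (hY : Tendsto (fun N : ℕ => Y N / N) atTop (𝓝 0))
    {k : ℕ → ℕ} (hk : ∀ N, k N ≤ N) : Tendsto (fun N : ℕ => Y (k N) / N) atTop (𝓝 0) := by
  rw [Metric.tendsto_atTop] at hY
  rw [tendsto_zero_iff_abs_tendsto_zero]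
  have hbound : ∀ ε > 0, ∃ B, ∀ n, |Y n| ≤ B + ε * n := by
    intro ε hε
    obtain ⟨K, hK⟩ := hY ε hε
    refine ⟨∑ n ∈ Finset.range (K + 1), |Y n|, fun n => ?_⟩
    have hB : 0 ≤ ∑ n ∈ Finset.range (K + 1), |Y n| := Finset.sum_nonneg fun _ _ => abs_nonneg _
    rcases lt_or_ge n (K + 1) with h | h
    · have := Finset.single_le_sum (f := fun n => |Y n|) (fun _ _ => abs_nonneg _)
        (Finset.mem_range.2 h)
      have h2 : 0 ≤ ε * n := by positivity

      linarith
    · have hn : (0 : ℝ) < n := by exact_mod_cast (by omega : 0 < n)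
      have h1 := hK n (by omega)
      rw [Real.dist_eq, sub_zero, abs_div, abs_of_pos hn, div_lt_iff₀ hn] at h1
      linarith
  rw [tendsto_order]
  refine ⟨fun a ha => Eventually.of_forall fun N => ha.trans_le (abs_nonneg _), fun ε hε => ?_⟩
  obtain ⟨B, hB⟩ := hbound (ε / 2) (half_pos hε)
  have h0 : Tendsto (fun n : ℕ => B / (n : ℝ)) atTop (𝓝 0) :=
    tendsto_const_nhds.div_atTop tendsto_natCast_atTop_atTop
  filter_upwards [h0.eventually_lt_const (half_pos hε), eventually_gt_atTop 0] with N hN hN0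
  have hn : (0 : ℝ) < N := by exact_mod_cast hN0
  have hkN : (k N : ℝ) ≤ N := by exact_mod_cast hk N
  simp only [Function.comp, abs_div, abs_of_pos hn]
  rw [div_lt_iff₀ hn] at hN ⊢
  nlinarith [hB (k N)]

theorem tendsto_sum_sub_div_zero {a : ℕ → ℝ} {m : ℝ}
    (h : Tendsto (fun N : ℕ => (∑ i ∈ Finset.range N, a i) / N) atTop (𝓝 m)) :
    Tendsto (fun N : ℕ => (∑ i ∈ Finset.range N, a i - m * N) / N) atTop (𝓝 0) := by
  have h1 := h.sub_const m
  rw [sub_self] at h1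
  refine h1.congr' ?_
  filter_upwards [eventually_gt_atTop 0] with N hN
  have hn : (N : ℝ) ≠ 0 := by exact_mod_cast hN.ne'
  field_simp

/-- A Lindley queue whose input does not exceed its service on average is rate stable. -/
theorem tendsto_lindley_div_zero {Q ξ : ℕ → ℝ} {m : ℝ} (hm : m ≤ 0) (h0 : Q 0 = 0)
    (hQ : ∀ N, Q (N + 1) = max (Q N + ξ N) 0)
    (hξ : Tendsto (fun N : ℕ => (∑ i ∈ Finset.range N, ξ i) / N) atTop (𝓝 m)) :
    Tendsto (fun N : ℕ => Q N / N) atTop (𝓝 0) := by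
  set S : ℕ → ℝ := fun N => ∑ i ∈ Finset.range N, ξ i with hS
  have hk : ∀ N, ∃ k ≤ N, Q N ≤ S N - S k := by
    intro N
    induction N with
    | zero => exact ⟨0, le_rfl, by simp [h0]⟩
    | succ N ih =>
      obtain ⟨k, hk, hle⟩ := ih
      have hSs : S (N + 1) = S N + ξ N := Finset.sum_range_succ _ _
      rw [hQ]
      rcases le_total (Q N + ξ N) 0 with h | h
      · exact ⟨N + 1, le_rfl, by rw [max_eq_right h, sub_self]⟩
      · exact ⟨k, by omega, by rw [max_eq_left h]; linarith⟩
  have hpos : ∀ N, 0 ≤ Q N := by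
    intro N
    cases N with
    | zero => exact h0.ge
    | succ N => rw [hQ]; exact le_max_right _ _
  choose k hkN hle using hk
  have hY := tendsto_sum_sub_div_zero hξ
  have hlim := hY.sub (tendsto_comp_div_zero (Y := fun N : ℕ => S N - m * N) hY hkN)
  rw [sub_zero] at hlim
  refine squeeze_zero (fun N => div_nonneg (hpos N) N.cast_nonneg) (fun N => ?_) hlim
  rw [← sub_div]
  gcongr
  have h1 : (k N : ℝ) ≤ N := by exact_mod_cast hkN N
  nlinarith [hle N]

section Fifo

open Protocol

variable {a d c : ℕ → ℝ}

open Classical in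
/-- In a first-in first-out buffer whose content grows sublinearly, almost all of the data `c` whose
indices `a` enter the buffer are delivered. -/
theorem tendsto_received_div {A c' : ℝ} (ha : ∀ i, 0 ≤ a i) (hc : ∀ i, 0 ≤ c i)
    (hda : ∀ N, ∑ k ∈ Finset.range N, d k ≤ ∑ k ∈ Finset.range N, a k)
    (hA : Tendsto (fun N : ℕ => (∑ i ∈ Finset.range N, a i) / N) atTop (𝓝 A))
    (hC : Tendsto (fun N : ℕ => (∑ i ∈ Finset.range N, c i) / N) atTop (𝓝 c'))
    (hQ : Tendsto (fun N : ℕ =>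
      (∑ i ∈ Finset.range N, a i - ∑ i ∈ Finset.range N, d i) / N) atTop (𝓝 0))
    (hA0 : A = 0 → ∀ i, a i = 0) :
    Tendsto (fun N : ℕ =>
      (∑ i ∈ Finset.range N, if IndexReceived a d i N then c i else 0) / N) atTop (𝓝 c') := by
  rcases eq_or_ne A 0 with hz | hz
  · simpa only [IndexReceived, hA0 hz, true_or, if_true] using hC
  have hApos : 0 < A := lt_of_le_of_ne (ge_of_tendsto' hA fun N =>
    div_nonneg (Finset.sum_nonneg fun i _ => ha i) N.cast_nonneg) hz.symm
  have hk : ∀ N, ∃ k ≤ N, (∀ i < k, IndexReceived a d i N) ∧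
      ∑ i ∈ Finset.range N, d i ≤ ∑ i ∈ Finset.range (min (k + 1) N), a i := by
    intro N
    by_cases h : ∃ i < N, ¬ IndexReceived a d i N
    · obtain ⟨m, ⟨hmN, hm⟩, hmin⟩ : ∃ m, (m < N ∧ ¬ IndexReceived a d m N) ∧
          ∀ j < m, ¬ (j < N ∧ ¬ IndexReceived a d j N) :=
        ⟨Nat.find h, Nat.find_spec h, fun j => Nat.find_min h⟩
      refine ⟨m, hmN.le, fun i hi => ?_, ?_⟩
      · by_contra hcon
        exact hmin i hi ⟨hi.trans hmN, hcon⟩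
      · simp only [IndexReceived, not_or, not_le] at hm
        rw [min_eq_left (show m + 1 ≤ N from hmN)]
        exact hm.2.le
    · push Not at h
      exact ⟨N, le_rfl, h, by rw [min_eq_right N.le_succ]; exact hda N⟩
  choose k hkN hrec hD using hk
  have hYA := tendsto_sum_sub_div_zero hA
  have hYC := tendsto_sum_sub_div_zero hC
  -- the delivered slots are asymptotically all slots
  have hgap : Tendsto (fun N : ℕ => ((N : ℝ) - k N) / N) atTop (𝓝 0) := by
    have h1 := tendsto_comp_div_zero
      (Y := fun N : ℕ => ∑ i ∈ Finset.range N, a i - A * N) hYA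
      (k := fun N => min (k N + 1) N) fun N => min_le_right _ _
    have h2 : Tendsto (fun N : ℕ => A / (N : ℝ)) atTop (𝓝 0) :=
      tendsto_const_nhds.div_atTop tendsto_natCast_atTop_atTop
    have h3 := ((((h1.sub hYA).add hQ).add h2).const_mul A⁻¹)
    simp only [sub_zero, add_zero, mul_zero] at h3
    refine squeeze_zero (fun N => div_nonneg
      (sub_nonneg.2 (by exact_mod_cast hkN N)) N.cast_nonneg) (fun N => ?_) h3
    rw [← sub_div, ← add_div, ← add_div, ← mul_div_assoc]
    gcongr
    rw [← div_eq_inv_mul, le_div_iff₀ hApos]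
    have h4 : ((min (k N + 1) N : ℕ) : ℝ) ≤ k N + 1 := by
      exact_mod_cast min_le_left _ _
    nlinarith [hD N]
  have hrest : Tendsto (fun N : ℕ =>
      (∑ i ∈ Finset.range N, c i - ∑ i ∈ Finset.range (k N), c i) / N) atTop (𝓝 0) := by
    have h1 := tendsto_comp_div_zero
      (Y := fun N : ℕ => ∑ i ∈ Finset.range N, c i - c' * N) hYC hkN
    have h2 := (hYC.sub h1).add (hgap.const_mul c')
    simp only [sub_zero, add_zero, mul_zero] at h2
    refine h2.congr fun N => ?_
    ring
  have hlow := hC.sub hrest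
  rw [sub_zero] at hlow
  refine tendsto_of_tendsto_of_tendsto_of_le_of_le hlow hC (fun N => ?_) (fun N => ?_)
  · simp only
    rw [← sub_div, sub_sub_cancel]
    gcongr
    calc ∑ i ∈ Finset.range (k N), c i
        = ∑ i ∈ Finset.range (k N), if IndexReceived a d i N then c i else 0 :=
          Finset.sum_congr rfl fun i hi => (if_pos (hrec N i (Finset.mem_range.1 hi))).symm
      _ ≤ _ := Finset.sum_le_sum_of_subset_of_nonneg
          (Finset.range_subset_range.2 (hkN N)) fun i _ _ => by split_ifs; exacts [hc i, le_rfl]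
  · simp only
    gcongr with i
    split_ifs
    exacts [le_rfl, hc i]

open Classical in
/-- The received indices of a first-in first-out buffer fit into the departures. -/
theorem sum_received_le (ha : ∀ i, 0 ≤ a i) (hd : ∀ i, 0 ≤ d i) (N : ℕ) :
    ∑ i ∈ Finset.range N, (if IndexReceived a d i N then a i else 0) ≤
      ∑ i ∈ Finset.range N, d i := by
  have key : ∀ M, ∑ i ∈ Finset.range M, (if IndexReceived a d i N then a i else 0) ≤
      ∑ i ∈ Finset.range N, d i ∧
      ∑ i ∈ Finset.range M, (if IndexReceived a d i N then a i else 0) ≤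
      ∑ i ∈ Finset.range M, a i := by
    intro M
    induction M with
    | zero => simpa using Finset.sum_nonneg fun i _ => hd i
    | succ M ih =>
      rw [Finset.sum_range_succ, Finset.sum_range_succ]
      by_cases h : IndexReceived a d M N
      · rw [if_pos h]
        refine ⟨?_, by linarith [ih.2]⟩
        rcases h with h | h
        · rw [h, add_zero]; exact ih.1
        · rw [Finset.sum_range_succ] at h
          linarith [ih.2]
      · rw [if_neg h]
        exact ⟨by linarith [ih.1], by linarith [ih.2, ha M]⟩
  exact (key N).1

end Fifo

/-! ### Capacities -/

@[simp]
theorem C_zero : C 0 = 0 := by simp [C]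

theorem C_le_C {x y : ℝ} (hx : 0 ≤ x) (hxy : x ≤ y) : C x ≤ C y :=
  Real.logb_le_logb_of_le one_lt_two (by linarith) (by linarith)

theorem C_lt_C {x y : ℝ} (hx : 0 ≤ x) (hxy : x < y) : C x < C y :=
  Real.logb_lt_logb one_lt_two (by linarith) (by linarith)

theorem C_nonneg {x : ℝ} (hx : 0 ≤ x) : 0 ≤ C x :=
  Real.logb_nonneg one_lt_two (by linarith)

theorem C_le_div_log {x : ℝ} (hx : 0 ≤ x) : C x ≤ x / Real.log 2 := by
  have := Real.log_le_sub_one_of_pos (show 0 < 1 + x by linarith)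
  unfold C Real.logb
  have h2 := Real.log_pos one_lt_two
  gcongr
  linarith

theorem C_add_le {x y : ℝ} (hx : 0 ≤ x) (hy : 0 ≤ y) : C (x + y) ≤ C x + C y := by
  unfold C
  rw [← Real.logb_mul (by positivity) (by positivity)]
  exact Real.logb_le_logb_of_le one_lt_two (by positivity) (by nlinarith [mul_nonneg hx hy])

theorem mul_C_le {θ x : ℝ} (hθ : 0 ≤ θ) (hθ1 : θ ≤ 1) (hx : 0 ≤ x) : θ * C x ≤ C (θ * x) := by
  have h := strictConcaveOn_log_Ioi.concaveOn.2 (x := 1 + x) (y := 1)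
    (show 0 < 1 + x by linarith) (Set.mem_Ioi.2 one_pos) hθ (sub_nonneg.2 hθ1) (by ring)
  simp only [smul_eq_mul, Real.log_one, mul_zero, add_zero, mul_one] at h
  have h2 := Real.log_pos one_lt_two
  unfold C Real.logb
  rw [← mul_div_assoc]
  gcongr
  exact h.trans_eq (by ring_nf)

/-- Superposition coding: decoding the first codeword with the second as noise and then the second
without noise achieves the full capacity. -/
theorem C_div_add_C {x y : ℝ} (hx : 0 ≤ x) (hy : 0 ≤ y) : C (x / (1 + y)) + C y = C (x + y) := by
  unfold C
  have h1 : 1 + y ≠ 0 := by positivity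
  rw [← Real.logb_mul (by positivity) h1]
  congr 1
  field_simp
  ring

theorem measurable_C : Measurable C :=
  (Real.measurable_log.comp (measurable_const.add measurable_id)).div_const _

namespace Policy

variable (π : Policy) {P₁ P₂ : ℝ} (s : State)

theorem q_nonneg (m : Mode) : 0 ≤ π.q s m := by unfold q; split_ifs <;> norm_num

theorem measurable_q (m : Mode) : Measurable fun s => π.q s m :=
  Measurable.ite (π.measurable_mode m) measurable_const measurable_const

theorem α₁_add : π.α₁ 0 s + π.α₁ 1 s = 1 := by simpa using π.α₁_sum s

theorem β₂_add : π.β₂ 0 s + π.β₂ 1 s = 1 := by simpa using π.β₂_sum s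

theorem α₃_add : π.α₃ 0 s + π.α₃ 1 s = 1 - π.α₃ 2 s := by
  have := π.α₃_sum s
  rw [Fin.sum_univ_three] at this
  linarith

theorem β₃_add : π.β₃ 0 s + π.β₃ 1 s = 1 - π.β₃ 2 s := by
  have := π.β₃_sum s
  rw [Fin.sum_univ_three] at this
  linarith

theorem sinr_nonneg {a b P g : ℝ} (ha : 0 ≤ a) (hb : 0 ≤ b) (hP : 0 ≤ P) (hg : 0 ≤ g) :
    0 ≤ a * P * g / (1 + b * P * g) := by positivity

theorem sinr_le {a b P g : ℝ} (ha : a ∈ Set.Icc (0 : ℝ) 1) (hb : 0 ≤ b) (hP : 0 ≤ P)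
    (hg : 0 ≤ g) : a * P * g / (1 + b * P * g) ≤ P * g := by
  have h1 : 0 ≤ P * g := mul_nonneg hP hg
  have h2 : 0 ≤ b * P * g := by positivity
  rw [div_le_iff₀ (by positivity)]
  nlinarith [mul_le_mul_of_nonneg_right ha.2 h1, mul_nonneg h1 h2]

theorem two_sqrt_le {a b u v : ℝ} (ha : a ∈ Set.Icc (0 : ℝ) 1) (hb : b ∈ Set.Icc (0 : ℝ) 1)
    (hu : 0 ≤ u) (hv : 0 ≤ v) : 2 * Real.sqrt (a * b * u * v) ≤ u + v := by
  have h1 : a * b ≤ 1 := mul_le_one₀ ha.2 hb.1 hb.2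
  have h2 : Real.sqrt (a * b * u * v) ≤ (u + v) / 2 := by
    refine Real.sqrt_le_iff.2 ⟨by positivity, ?_⟩
    nlinarith [sq_nonneg (u - v), mul_le_mul_of_nonneg_right h1 (mul_nonneg hu hv)]
  linarith

/-- The signal-to-noise ratio of the cooperative transmission to the macro BS. -/
noncomputable def snrSum (P₁ P₂ : ℝ) : ℝ :=
  P₁ * s 1 + P₂ * s 2 +
    2 * Real.sqrt ((π.α₃ 0 s + π.α₃ 1 s) * (π.β₃ 0 s + π.β₃ 1 s) * P₁ * P₂ * s 1 * s 2)

variable (hP₁ : 0 < P₁) (hP₂ : 0 < P₂)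

include hP₁ hP₂ in
theorem snrSum_mem : 0 ≤ π.snrSum s P₁ P₂ ∧ π.snrSum s P₁ P₂ ≤ 2 * (P₁ * s 1 + P₂ * s 2) := by
  have h1 : 0 ≤ P₁ * s 1 := by positivity
  have h2 : 0 ≤ P₂ * s 2 := by positivity
  have ha : π.α₃ 0 s + π.α₃ 1 s ∈ Set.Icc (0 : ℝ) 1 :=
    ⟨add_nonneg (π.α₃_mem 0 s).1 (π.α₃_mem 1 s).1, by
      rw [α₃_add]; linarith [(π.α₃_mem 2 s).1]⟩
  have hb : π.β₃ 0 s + π.β₃ 1 s ∈ Set.Icc (0 : ℝ) 1 :=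
    ⟨add_nonneg (π.β₃_mem 0 s).1 (π.β₃_mem 1 s).1, by
      rw [β₃_add]; linarith [(π.β₃_mem 2 s).1]⟩
  have h3 := two_sqrt_le ha hb h1 h2
  unfold snrSum
  refine ⟨by positivity, ?_⟩
  rw [show (π.α₃ 0 s + π.α₃ 1 s) * (π.β₃ 0 s + π.β₃ 1 s) * P₁ * P₂ * s 1 * s 2 =
    (π.α₃ 0 s + π.α₃ 1 s) * (π.β₃ 0 s + π.β₃ 1 s) * (P₁ * s 1) * (P₂ * s 2) by ring]
  linarith

include hP₁ in
theorem C12c_nonneg : 0 ≤ π.C12c P₁ s :=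
  C_nonneg (sinr_nonneg (π.α₁_mem 0 s).1 (π.α₁_mem 1 s).1 hP₁.le (s 0).2)

include hP₁ in
theorem C1dc_nonneg : 0 ≤ π.C1dc P₁ s :=
  C_nonneg (sinr_nonneg (π.α₁_mem 0 s).1 (π.α₁_mem 1 s).1 hP₁.le (s 1).2)

include hP₁ in
theorem C1dnc_nonneg : 0 ≤ π.C1dnc P₁ s :=
  C_nonneg (mul_nonneg (mul_nonneg (π.α₁_mem 1 s).1 hP₁.le) (s 1).2)

include hP₂ in
theorem C21c_nonneg : 0 ≤ π.C21c P₂ s :=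
  C_nonneg (sinr_nonneg (π.β₂_mem 0 s).1 (π.β₂_mem 1 s).1 hP₂.le (s 0).2)

include hP₂ in
theorem C2dc_nonneg : 0 ≤ π.C2dc P₂ s :=
  C_nonneg (sinr_nonneg (π.β₂_mem 0 s).1 (π.β₂_mem 1 s).1 hP₂.le (s 2).2)

include hP₂ in
theorem C2dnc_nonneg : 0 ≤ π.C2dnc P₂ s :=
  C_nonneg (mul_nonneg (mul_nonneg (π.β₂_mem 1 s).1 hP₂.le) (s 2).2)

include hP₁ in
theorem C1rnc_nonneg : 0 ≤ π.C1rnc P₁ s :=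
  C_nonneg (mul_nonneg (mul_nonneg (π.α₃_mem 2 s).1 hP₁.le) (s 1).2)

include hP₁ in
theorem C1dc_add_C1dnc : π.C1dc P₁ s + π.C1dnc P₁ s = C (P₁ * s 1) := by
  have h1 := (π.α₁_mem 0 s).1
  have h2 := (π.α₁_mem 1 s).1
  unfold C1dc C1dnc
  rw [C_div_add_C (by positivity) (by positivity)]
  congr 1
  rw [← add_mul, ← add_mul, α₁_add, one_mul]

include hP₂ in
theorem C2dc_add_C2dnc : π.C2dc P₂ s + π.C2dnc P₂ s = C (P₂ * s 2) := by
  have h1 := (π.β₂_mem 0 s).1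
  have h2 := (π.β₂_mem 1 s).1
  unfold C2dc C2dnc
  rw [C_div_add_C (by positivity) (by positivity)]
  congr 1
  rw [← add_mul, ← add_mul, β₂_add, one_mul]

include hP₁ hP₂ in
theorem snr_sum_nc_mem : 0 ≤ π.α₃ 2 s * P₁ * s 1 + π.β₃ 2 s * P₂ * s 2 ∧
    π.α₃ 2 s * P₁ * s 1 + π.β₃ 2 s * P₂ * s 2 ≤ P₁ * s 1 + P₂ * s 2 := by
  have h1 := π.α₃_mem 2 s
  have h2 := π.β₃_mem 2 s
  have h3 : 0 ≤ P₁ * s 1 := by positivity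
  have h4 : 0 ≤ P₂ * s 2 := by positivity
  rw [mul_assoc, mul_assoc]
  exact ⟨add_nonneg (mul_nonneg h1.1 h3) (mul_nonneg h2.1 h4),
    add_le_add (mul_le_of_le_one_left h3 h1.2) (mul_le_of_le_one_left h4 h2.2)⟩

include hP₁ hP₂ in
theorem Csumnc_nonneg : 0 ≤ π.Csumnc P₁ P₂ s := C_nonneg (π.snr_sum_nc_mem s hP₁ hP₂).1

include hP₁ hP₂ in
theorem Csumnc_le_Csumc : π.Csumnc P₁ P₂ s ≤ π.Csumc P₁ P₂ s := by
  refine C_le_C (π.snr_sum_nc_mem s hP₁ hP₂).1 ?_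
  have := (π.snr_sum_nc_mem s hP₁ hP₂).2
  exact this.trans (le_add_of_nonneg_right (by positivity))

include hP₁ hP₂ in
theorem C1rnc_le_Csumnc : π.C1rnc P₁ s ≤ π.Csumnc P₁ P₂ s := by
  have h1 := (π.α₃_mem 2 s).1
  have h2 := (π.β₃_mem 2 s).1
  exact C_le_C (by positivity) (le_add_of_nonneg_right (by positivity))

include hP₁ hP₂ in
theorem Csumnc_le_add : π.Csumnc P₁ P₂ s ≤ π.C1rnc P₁ s + π.C2rnc P₂ s := by
  have h1 := (π.α₃_mem 2 s).1
  have h2 := (π.β₃_mem 2 s).1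
  exact C_add_le (by positivity) (by positivity)

theorem measurable_C12c : Measurable fun s => π.C12c P₁ s := by
  have h1 := π.measurable_α₁ 0
  have h2 := π.measurable_α₁ 1
  exact measurable_C.comp (by fun_prop)

theorem measurable_C1dc : Measurable fun s => π.C1dc P₁ s := by
  have h1 := π.measurable_α₁ 0
  have h2 := π.measurable_α₁ 1
  exact measurable_C.comp (by fun_prop)

theorem measurable_C1dnc : Measurable fun s => π.C1dnc P₁ s := by
  have h2 := π.measurable_α₁ 1
  exact measurable_C.comp (by fun_prop)

theorem measurable_C21c : Measurable fun s => π.C21c P₂ s := by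
  have h1 := π.measurable_β₂ 0
  have h2 := π.measurable_β₂ 1
  exact measurable_C.comp (by fun_prop)

theorem measurable_C2dc : Measurable fun s => π.C2dc P₂ s := by
  have h1 := π.measurable_β₂ 0
  have h2 := π.measurable_β₂ 1
  exact measurable_C.comp (by fun_prop)

theorem measurable_C2dnc : Measurable fun s => π.C2dnc P₂ s := by
  have h2 := π.measurable_β₂ 1
  exact measurable_C.comp (by fun_prop)

theorem measurable_Csumnc : Measurable fun s => π.Csumnc P₁ P₂ s := by
  have h1 := π.measurable_α₃ 2
  have h2 := π.measurable_β₃ 2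
  exact measurable_C.comp (by fun_prop)

theorem measurable_Csumc : Measurable fun s => π.Csumc P₁ P₂ s := by
  have h1 := π.measurable_α₃ 0
  have h2 := π.measurable_α₃ 1
  have h3 := π.measurable_β₃ 0
  have h4 := π.measurable_β₃ 1
  exact measurable_C.comp (by fun_prop)

end Policy

/-! ### Averages over the fading law -/

/-- The expectation of a function of the fading state. -/
noncomputable def expect (ν : Measure Path) (g : State → ℝ) : ℝ := ∫ x, g (x 0) ∂ν

theorem expect_add {ν : Measure Path} (f g : State → ℝ)
    (hf : Integrable (fun x : Path => f (x 0)) ν) (hg : Integrable (fun x : Path => g (x 0)) ν) :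
    expect ν (fun s => f s + g s) = expect ν f + expect ν g :=
  integral_add hf hg

section Fading

variable {ν : Measure Path} (hν : IsFadingLaw ν) {g : State → ℝ}

include hν in
theorem IsFadingLaw.ae_tendsto_avg (hgm : Measurable g)
    (hg : Integrable (fun x : Path => g (x 0)) ν) :
    ∀ᵐ x ∂ν, Tendsto (fun N : ℕ => (∑ i ∈ Finset.range N, g (x i)) / N) atTop
      (𝓝 (expect ν g)) := by
  have := hν.isProbabilityMeasure
  have h := ae_tendsto_birkhoffSum_div hν.ergodic (f := fun x : Path => g (x 0))
    (hgm.comp (measurable_pi_apply 0)) hg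
  have hit : ∀ (i : ℕ) (x : Path), (fun (x : Path) (i : ℕ) => x (i + 1))^[i] x 0 = x i := by
    intro i
    induction i with
    | zero => intro x; rfl
    | succ i ih => intro x; rw [Function.iterate_succ_apply, ih]
  simpa only [birkhoffSum, hit, expect] using h

include hν in
theorem IsFadingLaw.ae_forall_eq_zero
    (hg : Integrable (fun x : Path => g (x 0)) ν) (hg0 : ∀ s, 0 ≤ g s) (hE : expect ν g = 0) :
    ∀ᵐ x ∂ν, ∀ i, g (x i) = 0 := by
  have h0 : ∀ᵐ x ∂ν, g (x 0) = 0 :=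
    (integral_eq_zero_iff_of_nonneg (fun x : Path => hg0 (x 0)) hg).1 hE
  rw [ae_all_iff]
  intro i
  induction i with
  | zero => exact h0
  | succ i ih => exact hν.ergodic.quasiMeasurePreserving.ae ih

include hν in
theorem IsFadingLaw.integrable_of_le (hgm : Measurable g) {K : ℝ} (hg0 : ∀ s, 0 ≤ g s)
    (hgK : ∀ s, g s ≤ K * ((s 0 : ℝ) + s 1 + s 2)) :
    Integrable (fun x : Path => g (x 0)) ν := by
  refine Integrable.mono'
    ((((hν.finite_mean 0).add (hν.finite_mean 1)).add (hν.finite_mean 2)).const_mul K)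
    (hgm.comp (measurable_pi_apply 0)).aestronglyMeasurable (Eventually.of_forall fun x => ?_)
  rw [Real.norm_of_nonneg (hg0 _)]
  exact hgK _

include hν in
theorem IsFadingLaw.integrable_q_mul_C (π : Policy) (m : Mode) {K : ℝ}
    {r : State → ℝ} (hCm : Measurable fun s => C (r s)) (hr0 : ∀ s, 0 ≤ r s)
    (hrK : ∀ s, r s ≤ K * ((s 0 : ℝ) + s 1 + s 2)) :
    Integrable (fun x : Path => π.q (x 0) m * C (r (x 0))) ν := by
  have hl := Real.log_pos one_lt_two
  refine hν.integrable_of_le (g := fun s => π.q s m * C (r s)) (K := K / Real.log 2)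
    ((π.measurable_q m).mul hCm)
    (fun s => mul_nonneg (π.q_nonneg s m) (C_nonneg (hr0 s))) fun s => ?_
  have h1 : π.q s m * C (r s) ≤ C (r s) :=
    mul_le_of_le_one_left (C_nonneg (hr0 s)) (by unfold Policy.q; split_ifs <;> norm_num)
  refine h1.trans ((C_le_div_log (hr0 s)).trans ?_)
  rw [div_mul_eq_mul_div]
  gcongr
  exact hrK s

end Fading

namespace Policy

/-! ### Rates offered by a policy in one slot -/

section Defs

variable (π : Policy) (P₁ P₂ : ℝ) (s : State)

/-- The rate of the cooperative codeword that BS 1 sends in mode `M1`. -/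
noncomputable def exchange₁ : ℝ := π.q s .M1 * π.C12c P₁ s

/-- The rate of the cooperative codeword that BS 2 sends in mode `M2`. -/
noncomputable def exchange₂ : ℝ := π.q s .M2 * π.C21c P₂ s

/-- The part of the cooperative codeword of BS 1 that the macro BS resolves directly. -/
noncomputable def direct₁ : ℝ := π.q s .M1 * min (π.C12c P₁ s) (π.C1dc P₁ s)

/-- The part of the cooperative codeword of BS 2 that the macro BS resolves directly. -/
noncomputable def direct₂ : ℝ := π.q s .M2 * min (π.C21c P₂ s) (π.C2dc P₂ s)

/-- The non-cooperative sum rate of a slot. -/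
noncomputable def noncoop : ℝ :=
  π.q s .M3 * π.Csumnc P₁ P₂ s + π.q s .M1 * π.C1dnc P₁ s + π.q s .M2 * π.C2dnc P₂ s

/-- The rate left in mode `M3` for the contents of the buffers. -/
noncomputable def service : ℝ := π.q s .M3 * (π.Csumc P₁ P₂ s - π.Csumnc P₁ P₂ s)

/-- The sum rate of a slot when every cooperative codeword is eventually delivered. -/
noncomputable def sentRate : ℝ := π.exchange₁ P₁ s + π.exchange₂ P₂ s + π.noncoop P₁ P₂ s

/-- The sum rate of a slot at the macro BS when the buffers are never empty. -/
noncomputable def receivableRate : ℝ :=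
  π.direct₁ P₁ s + π.direct₂ P₂ s + π.noncoop P₁ P₂ s + π.service P₁ P₂ s

end Defs

variable (π : Policy) {P₁ P₂ : ℝ} (s : State)

theorem measurable_exchange₁ : Measurable fun s => π.exchange₁ P₁ s :=
  (π.measurable_q _).mul π.measurable_C12c

theorem measurable_exchange₂ : Measurable fun s => π.exchange₂ P₂ s :=
  (π.measurable_q _).mul π.measurable_C21c

theorem measurable_direct₁ : Measurable fun s => π.direct₁ P₁ s :=
  (π.measurable_q _).mul (π.measurable_C12c.min π.measurable_C1dc)

theorem measurable_direct₂ : Measurable fun s => π.direct₂ P₂ s :=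
  (π.measurable_q _).mul (π.measurable_C21c.min π.measurable_C2dc)

theorem measurable_noncoop : Measurable fun s => π.noncoop P₁ P₂ s :=
  (((π.measurable_q _).mul π.measurable_Csumnc).add
    ((π.measurable_q _).mul π.measurable_C1dnc)).add ((π.measurable_q _).mul π.measurable_C2dnc)

theorem measurable_service : Measurable fun s => π.service P₁ P₂ s :=
  (π.measurable_q _).mul (π.measurable_Csumc.sub π.measurable_Csumnc)

theorem measurable_sentRate : Measurable fun s => π.sentRate P₁ P₂ s :=
  (π.measurable_exchange₁.add π.measurable_exchange₂).add π.measurable_noncoop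

theorem measurable_receivableRate : Measurable fun s => π.receivableRate P₁ P₂ s :=
  ((π.measurable_direct₁.add π.measurable_direct₂).add π.measurable_noncoop).add
    π.measurable_service

variable (hP₁ : 0 < P₁) (hP₂ : 0 < P₂)

include hP₁ in
theorem direct₁_nonneg : 0 ≤ π.direct₁ P₁ s :=
  mul_nonneg (π.q_nonneg _ _) (le_min (π.C12c_nonneg s hP₁) (π.C1dc_nonneg s hP₁))

include hP₂ in
theorem direct₂_nonneg : 0 ≤ π.direct₂ P₂ s :=
  mul_nonneg (π.q_nonneg _ _) (le_min (π.C21c_nonneg s hP₂) (π.C2dc_nonneg s hP₂))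

theorem direct₁_le_exchange₁ : π.direct₁ P₁ s ≤ π.exchange₁ P₁ s :=
  mul_le_mul_of_nonneg_left (min_le_left _ _) (π.q_nonneg _ _)

theorem direct₂_le_exchange₂ : π.direct₂ P₂ s ≤ π.exchange₂ P₂ s :=
  mul_le_mul_of_nonneg_left (min_le_left _ _) (π.q_nonneg _ _)

include hP₁ in
theorem exchange₁_nonneg : 0 ≤ π.exchange₁ P₁ s :=
  mul_nonneg (π.q_nonneg _ _) (π.C12c_nonneg s hP₁)

include hP₂ in
theorem exchange₂_nonneg : 0 ≤ π.exchange₂ P₂ s :=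
  mul_nonneg (π.q_nonneg _ _) (π.C21c_nonneg s hP₂)

include hP₁ hP₂ in
theorem noncoop_nonneg : 0 ≤ π.noncoop P₁ P₂ s :=
  add_nonneg (add_nonneg (mul_nonneg (π.q_nonneg _ _) (π.Csumnc_nonneg s hP₁ hP₂))
    (mul_nonneg (π.q_nonneg _ _) (π.C1dnc_nonneg s hP₁)))
    (mul_nonneg (π.q_nonneg _ _) (π.C2dnc_nonneg s hP₂))

include hP₁ hP₂ in
theorem service_nonneg : 0 ≤ π.service P₁ P₂ s :=
  mul_nonneg (π.q_nonneg _ _) (sub_nonneg.2 (π.Csumnc_le_Csumc s hP₁ hP₂))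

section Integrable

variable {ν : Measure Path} (hν : IsFadingLaw ν)

theorem mul_gain_le {P K : ℝ} (hP : 0 ≤ P) (hK : P ≤ K) (l : Fin 3) :
    P * s l ≤ K * ((s 0 : ℝ) + s 1 + s 2) := by
  have h0 : (0 : ℝ) ≤ s 0 := (s 0).2
  have h1 : (0 : ℝ) ≤ s 1 := (s 1).2
  have h2 : (0 : ℝ) ≤ s 2 := (s 2).2
  have hl : (s l : ℝ) ≤ (s 0 : ℝ) + s 1 + s 2 := by fin_cases l <;> simp <;> linarith
  exact mul_le_mul hK hl (s l).2 (hP.trans hK)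

include hν hP₁ in
theorem integrable_C12c : Integrable (fun x : Path => π.q (x 0) .M1 * π.C12c P₁ (x 0)) ν :=
  hν.integrable_q_mul_C π .M1 π.measurable_C12c
    (fun s => sinr_nonneg (π.α₁_mem 0 s).1 (π.α₁_mem 1 s).1 hP₁.le (s 0).2)
    fun s => (sinr_le (π.α₁_mem 0 s) (π.α₁_mem 1 s).1 hP₁.le (s 0).2).trans
      (mul_gain_le s hP₁.le le_rfl 0)

include hν hP₁ in
theorem integrable_C1dnc : Integrable (fun x : Path => π.q (x 0) .M1 * π.C1dnc P₁ (x 0)) ν := by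
  refine hν.integrable_q_mul_C π .M1 π.measurable_C1dnc
    (fun s => mul_nonneg (mul_nonneg (π.α₁_mem 1 s).1 hP₁.le) (s 1).2)
    fun s => le_trans ?_ (mul_gain_le s hP₁.le le_rfl 1)
  rw [mul_assoc]
  exact mul_le_of_le_one_left (mul_nonneg hP₁.le (s 1).2) (π.α₁_mem 1 s).2

include hν hP₂ in
theorem integrable_C21c : Integrable (fun x : Path => π.q (x 0) .M2 * π.C21c P₂ (x 0)) ν :=
  hν.integrable_q_mul_C π .M2 π.measurable_C21c
    (fun s => sinr_nonneg (π.β₂_mem 0 s).1 (π.β₂_mem 1 s).1 hP₂.le (s 0).2)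
    fun s => (sinr_le (π.β₂_mem 0 s) (π.β₂_mem 1 s).1 hP₂.le (s 0).2).trans
      (mul_gain_le s hP₂.le le_rfl 0)

include hν hP₂ in
theorem integrable_C2dnc : Integrable (fun x : Path => π.q (x 0) .M2 * π.C2dnc P₂ (x 0)) ν := by
  refine hν.integrable_q_mul_C π .M2 π.measurable_C2dnc
    (fun s => mul_nonneg (mul_nonneg (π.β₂_mem 1 s).1 hP₂.le) (s 2).2)
    fun s => le_trans ?_ (mul_gain_le s hP₂.le le_rfl 2)
  rw [mul_assoc]
  exact mul_le_of_le_one_left (mul_nonneg hP₂.le (s 2).2) (π.β₂_mem 1 s).2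

include hν hP₁ hP₂ in
theorem integrable_Csumnc :
    Integrable (fun x : Path => π.q (x 0) .M3 * π.Csumnc P₁ P₂ (x 0)) ν := by
  refine hν.integrable_q_mul_C π .M3 (K := P₁ + P₂) π.measurable_Csumnc
    (fun s => (π.snr_sum_nc_mem s hP₁ hP₂).1) fun s => (π.snr_sum_nc_mem s hP₁ hP₂).2.trans ?_
  rw [add_mul]
  exact add_le_add (mul_gain_le s hP₁.le le_rfl 1) (mul_gain_le s hP₂.le le_rfl 2)

include hν hP₁ hP₂ in
theorem integrable_Csumc :
    Integrable (fun x : Path => π.q (x 0) .M3 * π.Csumc P₁ P₂ (x 0)) ν := by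
  refine hν.integrable_q_mul_C π .M3 (K := 2 * (P₁ + P₂)) π.measurable_Csumc
    (fun s => (π.snrSum_mem s hP₁ hP₂).1) fun s => (π.snrSum_mem s hP₁ hP₂).2.trans ?_
  rw [mul_assoc, add_mul]
  exact mul_le_mul_of_nonneg_left
    (add_le_add (mul_gain_le s hP₁.le le_rfl 1) (mul_gain_le s hP₂.le le_rfl 2)) two_pos.le

include hν hP₁ in
theorem integrable_direct₁ : Integrable (fun x : Path => π.direct₁ P₁ (x 0)) ν :=
  (π.integrable_C12c hP₁ hν).mono'
    (π.measurable_direct₁.comp (measurable_pi_apply 0)).aestronglyMeasurable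
    (Eventually.of_forall fun x => by
      rw [Real.norm_of_nonneg (π.direct₁_nonneg _ hP₁)]
      exact π.direct₁_le_exchange₁ _)

include hν hP₂ in
theorem integrable_direct₂ : Integrable (fun x : Path => π.direct₂ P₂ (x 0)) ν :=
  (π.integrable_C21c hP₂ hν).mono'
    (π.measurable_direct₂.comp (measurable_pi_apply 0)).aestronglyMeasurable
    (Eventually.of_forall fun x => by
      rw [Real.norm_of_nonneg (π.direct₂_nonneg _ hP₂)]
      exact π.direct₂_le_exchange₂ _)

include hν hP₁ hP₂ in
theorem integrable_noncoop : Integrable (fun x : Path => π.noncoop P₁ P₂ (x 0)) ν :=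
  ((π.integrable_Csumnc hP₁ hP₂ hν).add (π.integrable_C1dnc hP₁ hν)).add
    (π.integrable_C2dnc hP₂ hν)

include hν hP₁ hP₂ in
theorem integrable_service : Integrable (fun x : Path => π.service P₁ P₂ (x 0)) ν := by
  simp only [service, mul_sub]
  exact (π.integrable_Csumc hP₁ hP₂ hν).sub (π.integrable_Csumnc hP₁ hP₂ hν)

include hν hP₁ hP₂ in
theorem integrable_sentRate : Integrable (fun x : Path => π.sentRate P₁ P₂ (x 0)) ν :=
  ((π.integrable_C12c hP₁ hν).add (π.integrable_C21c hP₂ hν)).add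
    (π.integrable_noncoop hP₁ hP₂ hν)

include hν hP₁ hP₂ in
theorem integrable_receivableRate :
    Integrable (fun x : Path => π.receivableRate P₁ P₂ (x 0)) ν :=
  (((π.integrable_direct₁ hP₁ hν).add (π.integrable_direct₂ hP₂ hν)).add
    (π.integrable_noncoop hP₁ hP₂ hν)).add (π.integrable_service hP₁ hP₂ hν)

include hν hP₁ hP₂ in
theorem expect_noncoop : expect ν (π.noncoop P₁ P₂) =
    π.avgCsumnc P₁ P₂ ν + π.avgC1dnc P₁ ν + π.avgC2dnc P₂ ν := by
  have h1 := π.integrable_Csumnc hP₁ hP₂ hν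
  have h2 := π.integrable_C1dnc hP₁ hν
  have h3 := π.integrable_C2dnc hP₂ hν
  exact (expect_add (fun s => π.q s .M3 * π.Csumnc P₁ P₂ s + π.q s .M1 * π.C1dnc P₁ s)
    (fun s => π.q s .M2 * π.C2dnc P₂ s) (h1.add h2) h3).trans
    (congrArg (· + π.avgC2dnc P₂ ν) (integral_add h1 h2))

include hν hP₁ hP₂ in
theorem expect_service : expect ν (π.service P₁ P₂) =
    π.avgCsumc P₁ P₂ ν - π.avgCsumnc P₁ P₂ ν := by
  simp only [expect, service, mul_sub]
  rw [integral_sub (π.integrable_Csumc hP₁ hP₂ hν) (π.integrable_Csumnc hP₁ hP₂ hν)]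
  rfl

theorem expect_exchange₁ : expect ν (π.exchange₁ P₁) = π.avgC12c P₁ ν := rfl

theorem expect_exchange₂ : expect ν (π.exchange₂ P₂) = π.avgC21c P₂ ν := rfl

include hν hP₁ hP₂ in
theorem expect_sentRate : expect ν (π.sentRate P₁ P₂) =
    expect ν (π.exchange₁ P₁) + expect ν (π.exchange₂ P₂) + expect ν (π.noncoop P₁ P₂) := by
  have h1 := π.integrable_C12c hP₁ hν
  have h2 := π.integrable_C21c hP₂ hν
  exact (expect_add (fun s => π.exchange₁ P₁ s + π.exchange₂ P₂ s) (π.noncoop P₁ P₂)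
    (h1.add h2) (π.integrable_noncoop hP₁ hP₂ hν)).trans
    (congrArg (· + expect ν (π.noncoop P₁ P₂)) (integral_add h1 h2))

include hν hP₁ hP₂ in
theorem expect_receivableRate : expect ν (π.receivableRate P₁ P₂) =
    expect ν (π.direct₁ P₁) + expect ν (π.direct₂ P₂) + expect ν (π.noncoop P₁ P₂) +
      expect ν (π.service P₁ P₂) := by
  have h1 := π.integrable_direct₁ hP₁ hν
  have h2 := π.integrable_direct₂ hP₂ hν
  have h3 := π.integrable_noncoop hP₁ hP₂ hν
  rw [← expect_add _ _ h1 h2, ← expect_add _ _ (h1.add h2) h3,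
    ← expect_add _ _ ((h1.add h2).add h3) (π.integrable_service hP₁ hP₂ hν)]
  rfl

include hν hP₁ hP₂ in
/-- Under the condition that the macro BS resolves no more than the BSs exchange, the queue balance
says that the two bounds on the sum rate agree. -/
theorem queueBalance_iff (hdir : π.DirectLeExchange P₁ P₂ ν) :
    π.QueueBalance P₁ P₂ ν ↔
      expect ν (π.sentRate P₁ P₂) = expect ν (π.receivableRate P₁ P₂) := by
  have h1 : expect ν (π.direct₁ P₁) = π.avgC1dc P₁ ν := by
    refine integral_congr_ae ?_
    filter_upwards [hdir] with x hx
    by_cases hm : π.mode (x 0) = .M1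
    · rw [direct₁, min_eq_right (hx.1 hm)]
    · simp [direct₁, q, hm]
  have h2 : expect ν (π.direct₂ P₂) = π.avgC2dc P₂ ν := by
    refine integral_congr_ae ?_
    filter_upwards [hdir] with x hx
    by_cases hm : π.mode (x 0) = .M2
    · rw [direct₂, min_eq_right (hx.2 hm)]
    · simp [direct₂, q, hm]
  rw [expect_sentRate π hP₁ hP₂ hν, expect_receivableRate π hP₁ hP₂ hν, h1, h2,
    expect_service π hP₁ hP₂ hν, expect_exchange₁, expect_exchange₂, QueueBalance]
  constructor <;> intro h <;> linarith

end Integrable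

end Policy

namespace Protocol

/-! ### Upper bounds along a realization -/

section Path

variable {P₁ P₂ : ℝ} (σ : Protocol P₁ P₂) (x : Path)

theorem queue_fst (N : ℕ) : (queue (σ.mode x) (σ.rates x) N).1 =
    ∑ i ∈ Finset.range N, σ.arrival₁ x i - ∑ i ∈ Finset.range N, σ.departure₁ x i := by
  induction N with
  | zero => simp [queue]
  | succ N ih =>
    rw [Finset.sum_range_succ, Finset.sum_range_succ, queue]
    cases hm : σ.mode x N <;>
      simp only [queueStep, arrival₁, departure₁, hm, reduceCtorEq, if_true,
        if_false] at ih ⊢ <;> linarith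

theorem queue_snd (N : ℕ) : (queue (σ.mode x) (σ.rates x) N).2 =
    ∑ i ∈ Finset.range N, σ.arrival₂ x i - ∑ i ∈ Finset.range N, σ.departure₂ x i := by
  induction N with
  | zero => simp [queue]
  | succ N ih =>
    rw [Finset.sum_range_succ, Finset.sum_range_succ, queue]
    cases hm : σ.mode x N <;>
      simp only [queueStep, arrival₂, departure₂, hm, reduceCtorEq, if_true,
        if_false] at ih ⊢ <;> linarith

theorem admissible_M1 {i : ℕ} (h : σ.mode x i = .M1) :
    (σ.rates x i).c₁ ≤ σ.policy.C12c P₁ (x i) ∧ (σ.rates x i).nc₁ ≤ σ.policy.C1dnc P₁ (x i) ∧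
      (σ.rates x i).t₁ ≤ min (σ.rates x i).c₁ (σ.policy.C1dc P₁ (x i)) ∧
      (σ.rates x i).c₂ = 0 ∧ (σ.rates x i).nc₂ = 0 ∧ (σ.rates x i).t₂ = 0 := by
  have := (σ.admissible x i).2
  rw [show σ.policy.mode (x i) = .M1 from h] at this
  exact this

theorem admissible_M2 {i : ℕ} (h : σ.mode x i = .M2) :
    (σ.rates x i).c₂ ≤ σ.policy.C21c P₂ (x i) ∧ (σ.rates x i).nc₂ ≤ σ.policy.C2dnc P₂ (x i) ∧
      (σ.rates x i).t₂ ≤ min (σ.rates x i).c₂ (σ.policy.C2dc P₂ (x i)) ∧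
      (σ.rates x i).c₁ = 0 ∧ (σ.rates x i).nc₁ = 0 ∧ (σ.rates x i).t₁ = 0 := by
  have := (σ.admissible x i).2
  rw [show σ.policy.mode (x i) = .M2 from h] at this
  exact this

theorem admissible_M3 {i : ℕ} (h : σ.mode x i = .M3) :
    (σ.rates x i).nc₁ ≤ σ.policy.C1rnc P₁ (x i) ∧ (σ.rates x i).nc₂ ≤ σ.policy.C2rnc P₂ (x i) ∧
      (σ.rates x i).c₁ ≤ (queue (σ.mode x) (σ.rates x) i).1 ∧
      (σ.rates x i).c₂ ≤ (queue (σ.mode x) (σ.rates x) i).2 ∧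
      (σ.rates x i).nc₁ + (σ.rates x i).nc₂ ≤ σ.policy.Csumnc P₁ P₂ (x i) ∧
      (σ.rates x i).nc₁ + (σ.rates x i).nc₂ + (σ.rates x i).c₁ + (σ.rates x i).c₂ ≤
        σ.policy.Csumc P₁ P₂ (x i) ∧ (σ.rates x i).t₁ = 0 ∧ (σ.rates x i).t₂ = 0 := by
  have := (σ.admissible x i).2
  rw [show σ.policy.mode (x i) = .M3 from h] at this
  exact this

theorem arrival₁_nonneg (i : ℕ) : 0 ≤ σ.arrival₁ x i := by
  unfold arrival₁
  split_ifs with h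
  · have := (σ.admissible_M2 x h).2.2.1.trans (min_le_left _ _)
    linarith
  · exact le_rfl

theorem arrival₂_nonneg (i : ℕ) : 0 ≤ σ.arrival₂ x i := by
  unfold arrival₂
  split_ifs with h
  · have := (σ.admissible_M1 x h).2.2.1.trans (min_le_left _ _)
    linarith
  · exact le_rfl

theorem departure₁_nonneg (i : ℕ) : 0 ≤ σ.departure₁ x i := by
  unfold departure₁
  split_ifs
  exacts [(σ.admissible x i).1.1, le_rfl]

theorem departure₂_nonneg (i : ℕ) : 0 ≤ σ.departure₂ x i := by
  unfold departure₂
  split_ifs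
  exacts [(σ.admissible x i).1.2.1, le_rfl]

theorem queue_nonneg (N : ℕ) : 0 ≤ (queue (σ.mode x) (σ.rates x) N).1 ∧
    0 ≤ (queue (σ.mode x) (σ.rates x) N).2 := by
  induction N with
  | zero => simp [queue]
  | succ N ih =>
    have h1 := σ.arrival₁_nonneg x N
    have h2 := σ.arrival₂_nonneg x N
    rw [queue]
    cases hm : σ.mode x N with
    | M1 =>
      rw [arrival₂, if_pos hm] at h2
      exact ⟨ih.1, by simp only [queueStep]; linarith⟩
    | M2 =>
      rw [arrival₁, if_pos hm] at h1
      exact ⟨by simp only [queueStep]; linarith, ih.2⟩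
    | M3 =>
      have h := σ.admissible_M3 x hm
      exact ⟨sub_nonneg.2 h.2.2.1, sub_nonneg.2 h.2.2.2.1⟩

theorem virtualQueue_nonneg (N : ℕ) : 0 ≤ σ.virtualQueue x N :=
  add_nonneg (σ.queue_nonneg x N).1 (σ.queue_nonneg x N).2

open Classical in
/-- Content of buffer `B₁` that was stored in slot `i` and is received after `N` slots. -/
noncomputable def received₁ (N i : ℕ) : ℝ :=
  if IndexReceived (σ.arrival₁ x) (σ.departure₁ x) i N then σ.arrival₁ x i else 0

open Classical in
/-- Content of buffer `B₂` that was stored in slot `i` and is received after `N` slots. -/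
noncomputable def received₂ (N i : ℕ) : ℝ :=
  if IndexReceived (σ.arrival₂ x) (σ.departure₂ x) i N then σ.arrival₂ x i else 0

variable (hP₁ : 0 < P₁) (hP₂ : 0 < P₂)

include hP₁ hP₂

theorem coopDecoded_le (N i : ℕ) : σ.coopDecoded x N i ≤
    σ.policy.exchange₁ P₁ (x i) + σ.policy.exchange₂ P₂ (x i) := by
  have h1 := σ.policy.exchange₁_nonneg (x i) hP₁
  have h2 := σ.policy.exchange₂_nonneg (x i) hP₂
  unfold coopDecoded
  cases hm : σ.mode x i with
  | M1 =>
    have h := (σ.admissible_M1 x hm).1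
    have he : σ.policy.exchange₁ P₁ (x i) = σ.policy.C12c P₁ (x i) := by
      simp [Policy.exchange₁, Policy.q, show σ.policy.mode (x i) = .M1 from hm]
    simp only
    split_ifs <;> linarith
  | M2 =>
    have h := (σ.admissible_M2 x hm).1
    have he : σ.policy.exchange₂ P₂ (x i) = σ.policy.C21c P₂ (x i) := by
      simp [Policy.exchange₂, Policy.q, show σ.policy.mode (x i) = .M2 from hm]
    simp only
    split_ifs <;> linarith
  | M3 => simp only; linarith

omit hP₁ hP₂ in
theorem noncoop_le (i : ℕ) : (σ.rates x i).nc₁ + (σ.rates x i).nc₂ ≤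
    σ.policy.noncoop P₁ P₂ (x i) := by
  cases hm : σ.mode x i with
  | M1 =>
    have h := σ.admissible_M1 x hm
    have he : σ.policy.noncoop P₁ P₂ (x i) = σ.policy.C1dnc P₁ (x i) := by
      simp [Policy.noncoop, Policy.q, show σ.policy.mode (x i) = .M1 from hm]
    linarith
  | M2 =>
    have h := σ.admissible_M2 x hm
    have he : σ.policy.noncoop P₁ P₂ (x i) = σ.policy.C2dnc P₂ (x i) := by
      simp [Policy.noncoop, Policy.q, show σ.policy.mode (x i) = .M2 from hm]
    linarith
  | M3 =>
    have h := σ.admissible_M3 x hm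
    have he : σ.policy.noncoop P₁ P₂ (x i) = σ.policy.Csumnc P₁ P₂ (x i) := by
      simp [Policy.noncoop, Policy.q, show σ.policy.mode (x i) = .M3 from hm]
    linarith

theorem departure_add_noncoop_le (i : ℕ) :
    σ.departure₁ x i + σ.departure₂ x i + ((σ.rates x i).nc₁ + (σ.rates x i).nc₂) ≤
      σ.policy.service P₁ P₂ (x i) + σ.policy.noncoop P₁ P₂ (x i) := by
  by_cases hm : σ.mode x i = .M3
  · have h := σ.admissible_M3 x hm
    have he : σ.policy.service P₁ P₂ (x i) + σ.policy.noncoop P₁ P₂ (x i) =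
        σ.policy.Csumc P₁ P₂ (x i) := by
      simp [Policy.service, Policy.noncoop, Policy.q, show σ.policy.mode (x i) = .M3 from hm]
    rw [departure₁, departure₂, if_pos hm, if_pos hm]
    linarith
  · rw [departure₁, departure₂, if_neg hm, if_neg hm]
    linarith [σ.noncoop_le x i, σ.policy.service_nonneg (x i) hP₁ hP₂]

theorem coopDecoded_le_direct_add_received (N i : ℕ) : σ.coopDecoded x N i ≤
    σ.policy.direct₁ P₁ (x i) + σ.policy.direct₂ P₂ (x i) +
      (σ.received₁ x N i + σ.received₂ x N i) := by
  have h1 := σ.policy.direct₁_nonneg (x i) hP₁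
  have h2 := σ.policy.direct₂_nonneg (x i) hP₂
  unfold coopDecoded received₁ received₂
  cases hm : σ.mode x i with
  | M1 =>
    have h := σ.admissible_M1 x hm
    have he : σ.policy.direct₁ P₁ (x i) =
        min (σ.policy.C12c P₁ (x i)) (σ.policy.C1dc P₁ (x i)) := by
      simp [Policy.direct₁, Policy.q, show σ.policy.mode (x i) = .M1 from hm]
    have h3 := h.2.2.1.trans (min_le_min_right (σ.policy.C1dc P₁ (x i)) h.1)
    have h4 : σ.arrival₁ x i = 0 := by simp [arrival₁, hm]
    have h5 : σ.arrival₂ x i = (σ.rates x i).c₁ - (σ.rates x i).t₁ := by simp [arrival₂, hm]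
    simp only [h4, ite_self]
    rw [h5]
    split_ifs <;> linarith
  | M2 =>
    have h := σ.admissible_M2 x hm
    have he : σ.policy.direct₂ P₂ (x i) =
        min (σ.policy.C21c P₂ (x i)) (σ.policy.C2dc P₂ (x i)) := by
      simp [Policy.direct₂, Policy.q, show σ.policy.mode (x i) = .M2 from hm]
    have h3 := h.2.2.1.trans (min_le_min_right (σ.policy.C2dc P₂ (x i)) h.1)
    have h4 : σ.arrival₂ x i = 0 := by simp [arrival₂, hm]
    have h5 : σ.arrival₁ x i = (σ.rates x i).c₂ - (σ.rates x i).t₂ := by simp [arrival₁, hm]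
    simp only [h4, ite_self]
    rw [h5]
    split_ifs <;> linarith
  | M3 =>
    have h4 : σ.arrival₁ x i = 0 := by simp [arrival₁, hm]
    have h5 : σ.arrival₂ x i = 0 := by simp [arrival₂, hm]
    simp only [h4, h5, ite_self]
    linarith

theorem unreceived_le (N i : ℕ) :
    (σ.arrival₁ x i - σ.received₁ x N i) + (σ.arrival₂ x i - σ.received₂ x N i) ≤
      σ.policy.exchange₁ P₁ (x i) + σ.policy.exchange₂ P₂ (x i) - σ.coopDecoded x N i := by
  have h1 := σ.policy.exchange₁_nonneg (x i) hP₁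
  have h2 := σ.policy.exchange₂_nonneg (x i) hP₂
  have h6 := (σ.admissible x i).1
  unfold coopDecoded received₁ received₂
  cases hm : σ.mode x i with
  | M1 =>
    have h := σ.admissible_M1 x hm
    have he : σ.policy.exchange₁ P₁ (x i) = σ.policy.C12c P₁ (x i) := by
      simp [Policy.exchange₁, Policy.q, show σ.policy.mode (x i) = .M1 from hm]
    have h4 : σ.arrival₁ x i = 0 := by simp [arrival₁, hm]
    have h5 : σ.arrival₂ x i = (σ.rates x i).c₁ - (σ.rates x i).t₁ := by simp [arrival₂, hm]
    simp only [h4, ite_self]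
    rw [h5]
    split_ifs <;> linarith
  | M2 =>
    have h := σ.admissible_M2 x hm
    have he : σ.policy.exchange₂ P₂ (x i) = σ.policy.C21c P₂ (x i) := by
      simp [Policy.exchange₂, Policy.q, show σ.policy.mode (x i) = .M2 from hm]
    have h4 : σ.arrival₂ x i = 0 := by simp [arrival₂, hm]
    have h5 : σ.arrival₁ x i = (σ.rates x i).c₂ - (σ.rates x i).t₂ := by simp [arrival₁, hm]
    simp only [h4, ite_self]
    rw [h5]
    split_ifs <;> linarith
  | M3 =>
    have h4 : σ.arrival₁ x i = 0 := by simp [arrival₁, hm]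
    have h5 : σ.arrival₂ x i = 0 := by simp [arrival₂, hm]
    simp only [h4, h5, ite_self]
    linarith

theorem coopAvg_le (N : ℕ) : σ.coopAvg x N ≤
    (∑ i ∈ Finset.range N,
      (σ.policy.exchange₁ P₁ (x i) + σ.policy.exchange₂ P₂ (x i))) / N := by
  unfold coopAvg
  gcongr with i
  exact σ.coopDecoded_le x hP₁ hP₂ N i

omit hP₁ hP₂ in
theorem noncoopAvg_le (N : ℕ) : σ.noncoopAvg x N ≤
    (∑ i ∈ Finset.range N, σ.policy.noncoop P₁ P₂ (x i)) / N := by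
  unfold noncoopAvg
  gcongr with i
  exact σ.noncoop_le x i

theorem sumAvg_le_receivableRate (N : ℕ) : σ.coopAvg x N + σ.noncoopAvg x N ≤
    (∑ i ∈ Finset.range N, σ.policy.receivableRate P₁ P₂ (x i)) / N := by
  unfold coopAvg noncoopAvg
  rw [← add_div]
  gcongr
  have h1 := Finset.sum_le_sum fun i (_ : i ∈ Finset.range N) =>
    σ.coopDecoded_le_direct_add_received x hP₁ hP₂ N i
  have h2 := Finset.sum_le_sum fun i (_ : i ∈ Finset.range N) =>
    σ.departure_add_noncoop_le x hP₁ hP₂ i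
  have h3 : ∑ i ∈ Finset.range N, σ.received₁ x N i ≤ _ :=
    sum_received_le (σ.arrival₁_nonneg x) (σ.departure₁_nonneg x) N
  have h4 : ∑ i ∈ Finset.range N, σ.received₂ x N i ≤ _ :=
    sum_received_le (σ.arrival₂_nonneg x) (σ.departure₂_nonneg x) N
  simp only [Policy.receivableRate, Finset.sum_add_distrib] at h1 h2 h3 h4 ⊢
  linarith

/-- The buffers hold no more than the cooperative information that is not decoded. -/
theorem virtualQueue_div_le (N : ℕ) : σ.virtualQueue x N / N ≤
    (∑ i ∈ Finset.range N,
      (σ.policy.exchange₁ P₁ (x i) + σ.policy.exchange₂ P₂ (x i))) / N - σ.coopAvg x N := by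
  unfold coopAvg
  rw [← sub_div]
  gcongr
  have h1 := Finset.sum_le_sum fun i (_ : i ∈ Finset.range N) => σ.unreceived_le x hP₁ hP₂ N i
  have h3 : ∑ i ∈ Finset.range N, σ.received₁ x N i ≤ _ :=
    sum_received_le (σ.arrival₁_nonneg x) (σ.departure₁_nonneg x) N
  have h4 : ∑ i ∈ Finset.range N, σ.received₂ x N i ≤ _ :=
    sum_received_le (σ.arrival₂_nonneg x) (σ.departure₂_nonneg x) N
  rw [virtualQueue, queue_fst, queue_snd]
  simp only [Finset.sum_add_distrib, Finset.sum_sub_distrib] at h1 h3 h4 ⊢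
  linarith

end Path

/-! ### Upper bounds on the rates -/

section Rates

variable {P₁ P₂ : ℝ} (σ : Protocol P₁ P₂) (hP₁ : 0 < P₁) (hP₂ : 0 < P₂)
  {ν : Measure Path} (hν : IsFadingLaw ν)

include hP₁ hP₂ hν

theorem ae_tendsto_exchange (π : Policy) : ∀ᵐ x ∂ν, Tendsto (fun N : ℕ =>
    (∑ i ∈ Finset.range N, (π.exchange₁ P₁ (x i) + π.exchange₂ P₂ (x i))) / N) atTop
      (𝓝 (π.avgC12c P₁ ν + π.avgC21c P₂ ν)) := by
  have h1 := π.integrable_C12c hP₁ hν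
  have h2 := π.integrable_C21c hP₂ hν
  have h := hν.ae_tendsto_avg (g := fun s => π.exchange₁ P₁ s + π.exchange₂ P₂ s)
    (π.measurable_exchange₁.add π.measurable_exchange₂) (h1.add h2)
  rwa [expect_add _ _ h1 h2] at h

theorem ae_tendsto_noncoop (π : Policy) : ∀ᵐ x ∂ν, Tendsto (fun N : ℕ =>
    (∑ i ∈ Finset.range N, π.noncoop P₁ P₂ (x i)) / N) atTop
      (𝓝 (π.avgCsumnc P₁ P₂ ν + π.avgC1dnc P₁ ν + π.avgC2dnc P₂ ν)) := by
  rw [← π.expect_noncoop hP₁ hP₂ hν]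
  exact hν.ae_tendsto_avg π.measurable_noncoop (π.integrable_noncoop hP₁ hP₂ hν)

theorem HasCoopRate.le {R : ℝ} (h : σ.HasCoopRate ν R) :
    R ≤ σ.policy.avgC12c P₁ ν + σ.policy.avgC21c P₂ ν := by
  have := hν.isProbabilityMeasure
  obtain ⟨x, hx, hx'⟩ := (Filter.Eventually.and h
    (ae_tendsto_exchange hP₁ hP₂ hν σ.policy)).exists
  exact le_of_tendsto_of_tendsto' hx hx' fun N => σ.coopAvg_le x hP₁ hP₂ N

theorem HasNoncoopRate.le {R : ℝ} (h : σ.HasNoncoopRate ν R) :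
    R ≤ σ.policy.avgCsumnc P₁ P₂ ν + σ.policy.avgC1dnc P₁ ν + σ.policy.avgC2dnc P₂ ν := by
  have := hν.isProbabilityMeasure
  obtain ⟨x, hx, hx'⟩ := (Filter.Eventually.and h
    (ae_tendsto_noncoop hP₁ hP₂ hν σ.policy)).exists
  exact le_of_tendsto_of_tendsto' hx hx' fun N => σ.noncoopAvg_le x N

theorem HasSumRate.le_sentRate {R : ℝ} (h : σ.HasSumRate ν R) :
    R ≤ expect ν (σ.policy.sentRate P₁ P₂) := by
  have := hν.isProbabilityMeasure
  obtain ⟨x, hx, hx'⟩ := (Filter.Eventually.and h (hν.ae_tendsto_avg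
    σ.policy.measurable_sentRate (σ.policy.integrable_sentRate hP₁ hP₂ hν))).exists
  refine le_of_tendsto_of_tendsto' hx hx' fun N => ?_
  refine (add_le_add (σ.coopAvg_le x hP₁ hP₂ N) (σ.noncoopAvg_le x N)).trans_eq ?_
  rw [← add_div, ← Finset.sum_add_distrib]
  rfl

theorem HasSumRate.le_receivableRate {R : ℝ} (h : σ.HasSumRate ν R) :
    R ≤ expect ν (σ.policy.receivableRate P₁ P₂) := by
  have := hν.isProbabilityMeasure
  obtain ⟨x, hx, hx'⟩ := (Filter.Eventually.and h (hν.ae_tendsto_avg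
    σ.policy.measurable_receivableRate (σ.policy.integrable_receivableRate hP₁ hP₂ hν))).exists
  exact le_of_tendsto_of_tendsto' hx hx' fun N => σ.sumAvg_le_receivableRate x hP₁ hP₂ N

/-- If the sum rate reaches the rate that the BSs send, then so does each of its two parts. -/
theorem HasSumRate.rates_of_eq_sentRate
    (h : σ.HasSumRate ν (expect ν (σ.policy.sentRate P₁ P₂))) :
    σ.RateStable ν ∧
      σ.HasCoopRate ν (σ.policy.avgC12c P₁ ν + σ.policy.avgC21c P₂ ν) ∧
      σ.HasNoncoopRate ν
        (σ.policy.avgCsumnc P₁ P₂ ν + σ.policy.avgC1dnc P₁ ν + σ.policy.avgC2dnc P₂ ν) := by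
  have he := σ.policy.expect_sentRate hP₁ hP₂ hν
  rw [σ.policy.expect_noncoop hP₁ hP₂ hν, Policy.expect_exchange₁, Policy.expect_exchange₂] at he
  have hE := ae_tendsto_exchange hP₁ hP₂ hν σ.policy
  have hN := ae_tendsto_noncoop hP₁ hP₂ hν σ.policy
  have hcoop : σ.HasCoopRate ν (σ.policy.avgC12c P₁ ν + σ.policy.avgC21c P₂ ν) := by
    filter_upwards [h, hE, hN] with x hx hxE hxN
    have hlow := hx.sub hxN
    rw [he, add_sub_cancel_right] at hlow
    refine tendsto_of_tendsto_of_tendsto_of_le_of_le hlow hxE (fun N => ?_)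
      fun N => σ.coopAvg_le x hP₁ hP₂ N
    have := σ.noncoopAvg_le x N
    simp only
    linarith
  refine ⟨?_, hcoop, ?_⟩
  · filter_upwards [hcoop, hE] with x hx hxE
    have hup := hxE.sub hx
    rw [sub_self] at hup
    exact squeeze_zero (fun N => div_nonneg (σ.virtualQueue_nonneg x N) N.cast_nonneg)
      (fun N => σ.virtualQueue_div_le x hP₁ hP₂ N) hup
  · filter_upwards [h, hcoop] with x hx hxC
    have := hx.sub hxC
    rw [he, add_sub_cancel_left] at this
    exact this.congr fun N => by ring

end Rates

end Protocol

/-! ### Greedy protocols -/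

namespace Policy

section Defs

variable (π : Policy) (P₁ P₂ θ : ℝ)

/-- The rates of the greedy protocol when the fraction `θ` of the refinement information is stored:
the broadcast modes use the remaining capacity in full, and mode `M3` empties the buffers as fast
as possible. -/
noncomputable def greedyRates (s : State) (Q : ℝ × ℝ) : SlotRates :=
  match π.mode s with
  | .M1 =>
      { c₁ := min (π.C12c P₁ s) (π.C1dc P₁ s) +
          θ * (π.C12c P₁ s - min (π.C12c P₁ s) (π.C1dc P₁ s))
        c₂ := 0
        nc₁ := π.C1dnc P₁ s
        nc₂ := 0
        t₁ := min (π.C12c P₁ s) (π.C1dc P₁ s)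
        t₂ := 0 }
  | .M2 =>
      { c₁ := 0
        c₂ := min (π.C21c P₂ s) (π.C2dc P₂ s) +
          θ * (π.C21c P₂ s - min (π.C21c P₂ s) (π.C2dc P₂ s))
        nc₁ := 0
        nc₂ := π.C2dnc P₂ s
        t₁ := 0
        t₂ := min (π.C21c P₂ s) (π.C2dc P₂ s) }
  | .M3 =>
      { c₁ := min Q.1 (π.service P₁ P₂ s)
        c₂ := min Q.2 (π.service P₁ P₂ s - min Q.1 (π.service P₁ P₂ s))
        nc₁ := π.C1rnc P₁ s
        nc₂ := π.Csumnc P₁ P₂ s - π.C1rnc P₁ s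
        t₁ := 0
        t₂ := 0 }

/-- The buffer contents under the greedy protocol. -/
noncomputable def greedyQueue (x : Path) : ℕ → ℝ × ℝ
  | 0 => (0, 0)
  | N + 1 => queueStep (π.mode (x N)) (π.greedyRates P₁ P₂ θ (x N) (greedyQueue x N))
      (greedyQueue x N)

theorem queue_greedyRates (x : Path) (N : ℕ) :
    queue (fun k => π.mode (x k))
      (fun k => π.greedyRates P₁ P₂ θ (x k) (π.greedyQueue P₁ P₂ θ x k)) N =
      π.greedyQueue P₁ P₂ θ x N := by
  induction N with
  | zero => rfl
  | succ N ih => rw [queue, ih, greedyQueue]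

theorem greedyQueue_congr {x y : Path} {N : ℕ} (h : ∀ k < N, x k = y k) :
    π.greedyQueue P₁ P₂ θ x N = π.greedyQueue P₁ P₂ θ y N := by
  induction N with
  | zero => rfl
  | succ N ih =>
    rw [greedyQueue, greedyQueue, ih fun k hk => h k (by omega), h N (by omega)]

end Defs

variable (π : Policy) {P₁ P₂ θ : ℝ} (hP₁ : 0 < P₁) (hP₂ : 0 < P₂) (hθ : θ ∈ Set.Icc (0 : ℝ) 1)

include hP₁ hP₂ hθ

theorem admissible_greedyRates (s : State) {Q : ℝ × ℝ} (hQ : 0 ≤ Q.1 ∧ 0 ≤ Q.2) :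
    Admissible π P₁ P₂ s Q (π.greedyRates P₁ P₂ θ s Q) := by
  unfold Admissible greedyRates
  cases hm : π.mode s with
  | M1 =>
    have h1 := le_min (π.C12c_nonneg s hP₁) (π.C1dc_nonneg s hP₁)
    have h2 := min_le_left (π.C12c P₁ s) (π.C1dc P₁ s)
    have h3 := min_le_right (π.C12c P₁ s) (π.C1dc P₁ s)
    have h4 := mul_nonneg hθ.1 (sub_nonneg.2 h2)
    have h5 := mul_le_of_le_one_left (sub_nonneg.2 h2) hθ.2
    have h6 := π.C1dnc_nonneg s hP₁
    simp only
    refine ⟨⟨by linarith, le_rfl, h6, le_rfl, h1, le_rfl⟩, by linarith, le_rfl,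
      le_min (by linarith) h3, by simp, by simp, by simp⟩
  | M2 =>
    have h1 := le_min (π.C21c_nonneg s hP₂) (π.C2dc_nonneg s hP₂)
    have h2 := min_le_left (π.C21c P₂ s) (π.C2dc P₂ s)
    have h3 := min_le_right (π.C21c P₂ s) (π.C2dc P₂ s)
    have h4 := mul_nonneg hθ.1 (sub_nonneg.2 h2)
    have h5 := mul_le_of_le_one_left (sub_nonneg.2 h2) hθ.2
    have h6 := π.C2dnc_nonneg s hP₂
    simp only
    refine ⟨⟨le_rfl, by linarith, le_rfl, h6, le_rfl, h1⟩, by linarith, le_rfl,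
      le_min (by linarith) h3, by simp, by simp, by simp⟩
  | M3 =>
    have h1 := π.service_nonneg s hP₁ hP₂
    have h2 : π.service P₁ P₂ s = π.Csumc P₁ P₂ s - π.Csumnc P₁ P₂ s := by
      simp [service, q, hm]
    have h3 := min_le_left Q.1 (π.service P₁ P₂ s)
    have h4 := min_le_right Q.1 (π.service P₁ P₂ s)
    have h5 := min_le_left Q.2 (π.service P₁ P₂ s - min Q.1 (π.service P₁ P₂ s))
    have h6 := min_le_right Q.2 (π.service P₁ P₂ s - min Q.1 (π.service P₁ P₂ s))
    have h7 := π.C1rnc_le_Csumnc s hP₁ hP₂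
    have h8 := π.Csumnc_le_add s hP₁ hP₂
    simp only
    refine ⟨⟨le_min hQ.1 h1, le_min hQ.2 (by linarith), π.C1rnc_nonneg s hP₁, by linarith, le_rfl,
      le_rfl⟩, le_rfl, by linarith, h3, h5, by linarith, by linarith, by simp, by simp⟩

theorem greedyQueue_nonneg (x : Path) (N : ℕ) :
    0 ≤ (π.greedyQueue P₁ P₂ θ x N).1 ∧ 0 ≤ (π.greedyQueue P₁ P₂ θ x N).2 := by
  induction N with
  | zero => exact ⟨le_rfl, le_rfl⟩
  | succ N ih =>
    have h := π.admissible_greedyRates hP₁ hP₂ hθ (x N) ih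
    rw [greedyQueue]
    obtain ⟨-, h⟩ := h
    generalize π.greedyRates P₁ P₂ θ (x N) (π.greedyQueue P₁ P₂ θ x N) = r at h ⊢
    cases hm : π.mode (x N) with
    | M1 =>
      rw [hm] at h
      have := h.2.2.1.trans (min_le_left _ _)
      exact ⟨ih.1, by simp only [queueStep]; linarith⟩
    | M2 =>
      rw [hm] at h
      have := h.2.2.1.trans (min_le_left _ _)
      exact ⟨by simp only [queueStep]; linarith, ih.2⟩
    | M3 =>
      rw [hm] at h
      exact ⟨sub_nonneg.2 h.2.2.1, sub_nonneg.2 h.2.2.2.1⟩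

end Policy

/-- The greedy protocol of a policy. -/
noncomputable def Policy.greedy (π : Policy) {P₁ P₂ θ : ℝ} (hP₁ : 0 < P₁) (hP₂ : 0 < P₂)
    (hθ : θ ∈ Set.Icc (0 : ℝ) 1) : Protocol P₁ P₂ where
  policy := π
  rates x k := π.greedyRates P₁ P₂ θ (x k) (π.greedyQueue P₁ P₂ θ x k)
  causal x y i h := by
    rw [h i le_rfl, π.greedyQueue_congr P₁ P₂ θ fun k hk => h k hk.le]
  admissible x i := by
    rw [π.queue_greedyRates]
    exact π.admissible_greedyRates hP₁ hP₂ hθ (x i) (π.greedyQueue_nonneg hP₁ hP₂ hθ x i)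

namespace Policy

section Slot

variable (π : Policy) {P₁ P₂ θ : ℝ} (hP₁ : 0 < P₁) (hP₂ : 0 < P₂) (hθ : θ ∈ Set.Icc (0 : ℝ) 1)
  (x : Path)

theorem greedy_arrival₁ (i : ℕ) : (π.greedy hP₁ hP₂ hθ).arrival₁ x i =
    θ * (π.exchange₂ P₂ (x i) - π.direct₂ P₂ (x i)) := by
  have hmode : (π.greedy hP₁ hP₂ hθ).mode x i = π.mode (x i) := rfl
  have hrates : (π.greedy hP₁ hP₂ hθ).rates x i =
    π.greedyRates P₁ P₂ θ (x i) (π.greedyQueue P₁ P₂ θ x i) := rfl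
  rw [Protocol.arrival₁, hmode, hrates]
  unfold exchange₂ direct₂ q greedyRates
  cases hm : π.mode (x i) <;> simp

theorem greedy_arrival₂ (i : ℕ) : (π.greedy hP₁ hP₂ hθ).arrival₂ x i =
    θ * (π.exchange₁ P₁ (x i) - π.direct₁ P₁ (x i)) := by
  have hmode : (π.greedy hP₁ hP₂ hθ).mode x i = π.mode (x i) := rfl
  have hrates : (π.greedy hP₁ hP₂ hθ).rates x i =
    π.greedyRates P₁ P₂ θ (x i) (π.greedyQueue P₁ P₂ θ x i) := rfl
  rw [Protocol.arrival₂, hmode, hrates]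
  unfold exchange₁ direct₁ q greedyRates
  cases hm : π.mode (x i) <;> simp

theorem greedy_noncoop (i : ℕ) : ((π.greedy hP₁ hP₂ hθ).rates x i).nc₁ +
    ((π.greedy hP₁ hP₂ hθ).rates x i).nc₂ = π.noncoop P₁ P₂ (x i) := by
  unfold noncoop q
  simp only [greedy, greedyRates]
  cases hm : π.mode (x i) <;> simp

open Classical Protocol in
theorem greedy_coopDecoded (N i : ℕ) : (π.greedy hP₁ hP₂ hθ).coopDecoded x N i =
    (if IndexReceived ((π.greedy hP₁ hP₂ hθ).arrival₂ x) ((π.greedy hP₁ hP₂ hθ).departure₂ x) i N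
      then π.direct₁ P₁ (x i) + θ * (π.exchange₁ P₁ (x i) - π.direct₁ P₁ (x i)) else 0) +
    (if IndexReceived ((π.greedy hP₁ hP₂ hθ).arrival₁ x) ((π.greedy hP₁ hP₂ hθ).departure₁ x) i N
      then π.direct₂ P₂ (x i) + θ * (π.exchange₂ P₂ (x i) - π.direct₂ P₂ (x i)) else 0) := by
  unfold coopDecoded
  have hmode : (π.greedy hP₁ hP₂ hθ).mode x i = π.mode (x i) := rfl
  have hrates : (π.greedy hP₁ hP₂ hθ).rates x i =
    π.greedyRates P₁ P₂ θ (x i) (π.greedyQueue P₁ P₂ θ x i) := rfl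
  rw [hmode, hrates]
  unfold direct₁ direct₂ exchange₁ exchange₂ q greedyRates
  cases hm : π.mode (x i) <;> simp

theorem greedy_virtualQueue_succ (N : ℕ) : (π.greedy hP₁ hP₂ hθ).virtualQueue x (N + 1) =
    max ((π.greedy hP₁ hP₂ hθ).virtualQueue x N +
      (θ * (π.exchange₁ P₁ (x N) - π.direct₁ P₁ (x N)) +
        θ * (π.exchange₂ P₂ (x N) - π.direct₂ P₂ (x N)) - π.service P₁ P₂ (x N))) 0 := by
  have hQ : ∀ N, (π.greedy hP₁ hP₂ hθ).virtualQueue x N =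
      (π.greedyQueue P₁ P₂ θ x N).1 + (π.greedyQueue P₁ P₂ θ x N).2 := fun N => by
    have := π.queue_greedyRates P₁ P₂ θ x N
    rw [← this]
    rfl
  have h0 := (π.greedy hP₁ hP₂ hθ).virtualQueue_nonneg x (N + 1)
  have hs := π.service_nonneg (x N) hP₁ hP₂
  have hq := π.greedyQueue_nonneg hP₁ hP₂ hθ x N
  rw [hQ] at h0
  rw [hQ, hQ]
  rw [greedyQueue] at h0 ⊢
  generalize π.greedyQueue P₁ P₂ θ x N = Q at h0 hq ⊢
  unfold queueStep greedyRates at h0 ⊢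
  cases hm : π.mode (x N) with
  | M1 =>
    have h1 : π.service P₁ P₂ (x N) = 0 := by simp [service, q, hm]
    have h2 : π.exchange₂ P₂ (x N) = 0 := by simp [exchange₂, q, hm]
    have h3 : π.direct₂ P₂ (x N) = 0 := by simp [direct₂, q, hm]
    have h4 : π.exchange₁ P₁ (x N) = π.C12c P₁ (x N) := by simp [exchange₁, q, hm]
    have h5 : π.direct₁ P₁ (x N) = min (π.C12c P₁ (x N)) (π.C1dc P₁ (x N)) := by
      simp [direct₁, q, hm]
    rw [hm] at h0
    rw [h1, h2, h3, h4, h5, max_eq_left]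
    · ring
    · simp only at h0
      linarith
  | M2 =>
    have h1 : π.service P₁ P₂ (x N) = 0 := by simp [service, q, hm]
    have h2 : π.exchange₁ P₁ (x N) = 0 := by simp [exchange₁, q, hm]
    have h3 : π.direct₁ P₁ (x N) = 0 := by simp [direct₁, q, hm]
    have h4 : π.exchange₂ P₂ (x N) = π.C21c P₂ (x N) := by simp [exchange₂, q, hm]
    have h5 : π.direct₂ P₂ (x N) = min (π.C21c P₂ (x N)) (π.C2dc P₂ (x N)) := by
      simp [direct₂, q, hm]
    rw [hm] at h0
    rw [h1, h2, h3, h4, h5, max_eq_left]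
    · ring
    · simp only at h0
      linarith
  | M3 =>
    have h2 : π.exchange₁ P₁ (x N) = 0 := by simp [exchange₁, q, hm]
    have h3 : π.direct₁ P₁ (x N) = 0 := by simp [direct₁, q, hm]
    have h4 : π.exchange₂ P₂ (x N) = 0 := by simp [exchange₂, q, hm]
    have h5 : π.direct₂ P₂ (x N) = 0 := by simp [direct₂, q, hm]
    rw [h2, h3, h4, h5]
    simp only
    rcases le_total Q.1 (π.service P₁ P₂ (x N)) with h | h
    · rw [min_eq_left h]
      rcases le_total Q.2 (π.service P₁ P₂ (x N) - Q.1) with h' | h'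
      · rw [min_eq_left h', max_eq_right (by linarith)]
        ring
      · rw [min_eq_right h', max_eq_left (by linarith)]
        ring
    · rw [min_eq_right h, sub_self, min_eq_right hq.2, max_eq_left (by linarith)]
      ring

end Slot

section Rates

variable (π : Policy) {P₁ P₂ θ : ℝ} (hP₁ : 0 < P₁) (hP₂ : 0 < P₂) (hθ : θ ∈ Set.Icc (0 : ℝ) 1)
  {ν : Measure Path} (hν : IsFadingLaw ν)

include hν in
theorem greedy_hasNoncoopRate :
    (π.greedy hP₁ hP₂ hθ).HasNoncoopRate ν (expect ν (π.noncoop P₁ P₂)) := by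
  filter_upwards [hν.ae_tendsto_avg π.measurable_noncoop (π.integrable_noncoop hP₁ hP₂ hν)]
    with x hx
  simpa only [Protocol.noncoopAvg, greedy_noncoop] using hx

variable (hstable : θ * (expect ν (π.exchange₁ P₁) - expect ν (π.direct₁ P₁) +
    (expect ν (π.exchange₂ P₂) - expect ν (π.direct₂ P₂))) ≤ expect ν (π.service P₁ P₂))

theorem tendsto_combination {a b : ℕ → ℝ} {A B : ℝ} (c : ℝ) (d : ℝ)
    (ha : Tendsto (fun N : ℕ => (∑ i ∈ Finset.range N, a i) / N) atTop (𝓝 A))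
    (hb : Tendsto (fun N : ℕ => (∑ i ∈ Finset.range N, b i) / N) atTop (𝓝 B)) :
    Tendsto (fun N : ℕ => (∑ i ∈ Finset.range N, (c * a i + d * b i)) / N) atTop
      (𝓝 (c * A + d * B)) := by
  refine ((ha.const_mul c).add (hb.const_mul d)).congr fun N => ?_
  rw [Finset.sum_add_distrib, ← Finset.mul_sum, ← Finset.mul_sum, add_div, mul_div_assoc,
    mul_div_assoc]

include hP₁ hν in
theorem ae_tendsto_stored₁ : ∀ᵐ x ∂ν, Tendsto (fun N : ℕ =>
    (∑ i ∈ Finset.range N, θ * (π.exchange₁ P₁ (x i) - π.direct₁ P₁ (x i))) / N) atTop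
      (𝓝 (θ * (expect ν (π.exchange₁ P₁) - expect ν (π.direct₁ P₁)))) := by
  filter_upwards [hν.ae_tendsto_avg π.measurable_exchange₁ (π.integrable_C12c hP₁ hν),
    hν.ae_tendsto_avg π.measurable_direct₁ (π.integrable_direct₁ hP₁ hν)] with x h1 h2
  convert tendsto_combination θ (-θ) h1 h2 using 5 <;> ring

include hP₂ hν in
theorem ae_tendsto_stored₂ : ∀ᵐ x ∂ν, Tendsto (fun N : ℕ =>
    (∑ i ∈ Finset.range N, θ * (π.exchange₂ P₂ (x i) - π.direct₂ P₂ (x i))) / N) atTop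
      (𝓝 (θ * (expect ν (π.exchange₂ P₂) - expect ν (π.direct₂ P₂)))) := by
  filter_upwards [hν.ae_tendsto_avg π.measurable_exchange₂ (π.integrable_C21c hP₂ hν),
    hν.ae_tendsto_avg π.measurable_direct₂ (π.integrable_direct₂ hP₂ hν)] with x h1 h2
  convert tendsto_combination θ (-θ) h1 h2 using 5 <;> ring

include hν hstable in
theorem greedy_rateStable : (π.greedy hP₁ hP₂ hθ).RateStable ν := by
  filter_upwards [π.ae_tendsto_stored₁ (θ := θ) hP₁ hν, π.ae_tendsto_stored₂ (θ := θ) hP₂ hν,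
    hν.ae_tendsto_avg π.measurable_service (π.integrable_service hP₁ hP₂ hν)] with x h1 h2 h3
  refine tendsto_lindley_div_zero (sub_nonpos.2 hstable) (by simp [Protocol.virtualQueue, queue])
    (π.greedy_virtualQueue_succ hP₁ hP₂ hθ x) ?_
  convert (h1.add h2).sub h3 using 2
  · rw [← add_div, ← sub_div, ← Finset.sum_add_distrib, ← Finset.sum_sub_distrib]
  · ring

include hP₁ hν in
theorem ae_stored₁_eq_zero (h : θ * (expect ν (π.exchange₁ P₁) - expect ν (π.direct₁ P₁)) = 0) :
    ∀ᵐ x ∂ν, ∀ i : ℕ, θ * (π.exchange₁ P₁ (x i) - π.direct₁ P₁ (x i)) = 0 := by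
  rcases mul_eq_zero.1 h with h | h
  · simp [h]
  have hi := (π.integrable_C12c hP₁ hν).sub (π.integrable_direct₁ hP₁ hν)
  have := hν.ae_forall_eq_zero (g := fun s => π.exchange₁ P₁ s - π.direct₁ P₁ s) hi
    (fun s => sub_nonneg.2 (π.direct₁_le_exchange₁ s))
    ((integral_sub (π.integrable_C12c hP₁ hν) (π.integrable_direct₁ hP₁ hν)).trans h)
  filter_upwards [this] with x hx i
  rw [hx i, mul_zero]

include hP₂ hν in
theorem ae_stored₂_eq_zero (h : θ * (expect ν (π.exchange₂ P₂) - expect ν (π.direct₂ P₂)) = 0) :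
    ∀ᵐ x ∂ν, ∀ i : ℕ, θ * (π.exchange₂ P₂ (x i) - π.direct₂ P₂ (x i)) = 0 := by
  rcases mul_eq_zero.1 h with h | h
  · simp [h]
  have hi := (π.integrable_C21c hP₂ hν).sub (π.integrable_direct₂ hP₂ hν)
  have := hν.ae_forall_eq_zero (g := fun s => π.exchange₂ P₂ s - π.direct₂ P₂ s) hi
    (fun s => sub_nonneg.2 (π.direct₂_le_exchange₂ s))
    ((integral_sub (π.integrable_C21c hP₂ hν) (π.integrable_direct₂ hP₂ hν)).trans h)
  filter_upwards [this] with x hx i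
  rw [hx i, mul_zero]

include hν hstable in
theorem greedy_hasCoopRate : (π.greedy hP₁ hP₂ hθ).HasCoopRate ν
    (expect ν (π.direct₁ P₁) + θ * (expect ν (π.exchange₁ P₁) - expect ν (π.direct₁ P₁)) +
      (expect ν (π.direct₂ P₂) + θ * (expect ν (π.exchange₂ P₂) - expect ν (π.direct₂ P₂)))) := by
  set σ := π.greedy hP₁ hP₂ hθ with hσ
  have hz1 : ∀ᵐ x ∂ν, θ * (expect ν (π.exchange₁ P₁) - expect ν (π.direct₁ P₁)) = 0 →
      ∀ i, σ.arrival₂ x i = 0 := by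
    by_cases h : θ * (expect ν (π.exchange₁ P₁) - expect ν (π.direct₁ P₁)) = 0
    · filter_upwards [π.ae_stored₁_eq_zero hP₁ hν h] with x hx _ i
      rw [hσ, greedy_arrival₂, hx]
    · exact Eventually.of_forall fun x h' => absurd h' h
  have hz2 : ∀ᵐ x ∂ν, θ * (expect ν (π.exchange₂ P₂) - expect ν (π.direct₂ P₂)) = 0 →
      ∀ i, σ.arrival₁ x i = 0 := by
    by_cases h : θ * (expect ν (π.exchange₂ P₂) - expect ν (π.direct₂ P₂)) = 0
    · filter_upwards [π.ae_stored₂_eq_zero hP₂ hν h] with x hx _ i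
      rw [hσ, greedy_arrival₁, hx]
    · exact Eventually.of_forall fun x h' => absurd h' h
  filter_upwards [π.ae_tendsto_stored₁ (θ := θ) hP₁ hν, π.ae_tendsto_stored₂ (θ := θ) hP₂ hν,
    hν.ae_tendsto_avg π.measurable_direct₁ (π.integrable_direct₁ hP₁ hν),
    hν.ae_tendsto_avg π.measurable_direct₂ (π.integrable_direct₂ hP₂ hν), hz1, hz2,
    π.greedy_rateStable hP₁ hP₂ hθ hν hstable] with x ha1 ha2 hd1 hd2 hz1 hz2 hQ
  have hq := fun N => σ.queue_nonneg x N
  have hQ1 : Tendsto (fun N : ℕ => (∑ i ∈ Finset.range N, σ.arrival₁ x i -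
      ∑ i ∈ Finset.range N, σ.departure₁ x i) / N) atTop (𝓝 0) := by
    simp_rw [← σ.queue_fst]
    refine squeeze_zero (fun N => div_nonneg (hq N).1 N.cast_nonneg) (fun N => ?_) hQ
    gcongr
    exact le_add_of_nonneg_right (hq N).2
  have hQ2 : Tendsto (fun N : ℕ => (∑ i ∈ Finset.range N, σ.arrival₂ x i -
      ∑ i ∈ Finset.range N, σ.departure₂ x i) / N) atTop (𝓝 0) := by
    simp_rw [← σ.queue_snd]
    refine squeeze_zero (fun N => div_nonneg (hq N).2 N.cast_nonneg) (fun N => ?_) hQ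
    gcongr
    exact le_add_of_nonneg_left (hq N).1
  have hD1 : ∀ N, ∑ k ∈ Finset.range N, σ.departure₁ x k ≤ ∑ k ∈ Finset.range N, σ.arrival₁ x k :=
    fun N => sub_nonneg.1 (by rw [← σ.queue_fst]; exact (hq N).1)
  have hD2 : ∀ N, ∑ k ∈ Finset.range N, σ.departure₂ x k ≤ ∑ k ∈ Finset.range N, σ.arrival₂ x k :=
    fun N => sub_nonneg.1 (by rw [← σ.queue_snd]; exact (hq N).2)
  have hc1 : ∀ i, 0 ≤ π.direct₁ P₁ (x i) + θ * (π.exchange₁ P₁ (x i) - π.direct₁ P₁ (x i)) :=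
    fun i => add_nonneg (π.direct₁_nonneg _ hP₁)
      (mul_nonneg hθ.1 (sub_nonneg.2 (π.direct₁_le_exchange₁ _)))
  have hc2 : ∀ i, 0 ≤ π.direct₂ P₂ (x i) + θ * (π.exchange₂ P₂ (x i) - π.direct₂ P₂ (x i)) :=
    fun i => add_nonneg (π.direct₂_nonneg _ hP₂)
      (mul_nonneg hθ.1 (sub_nonneg.2 (π.direct₂_le_exchange₂ _)))
  have hC1 := tendsto_combination 1 1 hd1 ha1
  have hC2 := tendsto_combination 1 1 hd2 ha2
  simp only [one_mul] at hC1 hC2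
  simp_rw [← greedy_arrival₂ π hP₁ hP₂ hθ x] at ha1
  simp_rw [← greedy_arrival₁ π hP₁ hP₂ hθ x] at ha2
  have h1 := tendsto_received_div (σ.arrival₂_nonneg x) hc1 hD2 ha1 hC1 hQ2 hz1
  have h2 := tendsto_received_div (σ.arrival₁_nonneg x) hc2 hD1 ha2 hC2 hQ1 hz2
  refine (h1.add h2).congr fun N => ?_
  rw [← add_div, ← Finset.sum_add_distrib, Protocol.coopAvg]
  congr 1
  exact Finset.sum_congr rfl fun i _ => (π.greedy_coopDecoded hP₁ hP₂ hθ x N i).symm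

include hP₁ hP₂ hν in
/-- Every policy has a protocol whose sum rate is the smaller one of the two bounds. -/
theorem exists_hasSumRate : ∃ σ : Protocol P₁ P₂, σ.HasSumRate ν
    (min (expect ν (π.sentRate P₁ P₂)) (expect ν (π.receivableRate P₁ P₂))) := by
  have hE1 : expect ν (π.direct₁ P₁) ≤ expect ν (π.exchange₁ P₁) :=
    integral_mono (π.integrable_direct₁ hP₁ hν) (π.integrable_C12c hP₁ hν)
      fun x => π.direct₁_le_exchange₁ (x 0)
  have hE2 : expect ν (π.direct₂ P₂) ≤ expect ν (π.exchange₂ P₂) :=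
    integral_mono (π.integrable_direct₂ hP₂ hν) (π.integrable_C21c hP₂ hν)
      fun x => π.direct₂_le_exchange₂ (x 0)
  have hS : 0 ≤ expect ν (π.service P₁ P₂) :=
    integral_nonneg fun x => π.service_nonneg (x 0) hP₁ hP₂
  rw [π.expect_sentRate hP₁ hP₂ hν, π.expect_receivableRate hP₁ hP₂ hν]
  set A := expect ν (π.exchange₁ P₁) - expect ν (π.direct₁ P₁) +
    (expect ν (π.exchange₂ P₂) - expect ν (π.direct₂ P₂)) with hA
  have hA0 : 0 ≤ A := add_nonneg (sub_nonneg.2 hE1) (sub_nonneg.2 hE2)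
  obtain ⟨θ, hθ, hθA⟩ : ∃ θ ∈ Set.Icc (0 : ℝ) 1, θ * A = min A (expect ν (π.service P₁ P₂)) := by
    rcases le_or_gt A (expect ν (π.service P₁ P₂)) with h | h
    · exact ⟨1, ⟨zero_le_one, le_rfl⟩, by rw [min_eq_left h, one_mul]⟩
    · have hApos := hS.trans_lt h
      exact ⟨expect ν (π.service P₁ P₂) / A, ⟨div_nonneg hS hA0, (div_le_one hApos).2 h.le⟩, by
        rw [min_eq_right h.le, div_mul_cancel₀ _ hApos.ne']⟩
  refine ⟨π.greedy hP₁ hP₂ hθ, ?_⟩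
  filter_upwards [π.greedy_hasCoopRate hP₁ hP₂ hθ hν (hθA.trans_le (min_le_right _ _)),
    π.greedy_hasNoncoopRate hP₁ hP₂ hθ hν] with x h1 h2
  convert h1.add h2 using 2
  rw [show ∀ a b c d e : ℝ, a + θ * (b - a) + (c + θ * (d - c)) + e =
    a + c + e + θ * (b - a + (d - c)) by intros; ring, ← hA, hθA, ← min_add_add_left]
  congr 1
  rw [hA]
  ring

end Rates

end Policy

/-! ### Better policies -/

theorem exists_setIntegral_lt {Ω : Type*} [MeasurableSpace Ω] {μ : Measure Ω} {h : Ω → ℝ}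
    (hm : Measurable h) (h0 : ∀ ω, 0 ≤ h ω) (hac : μ.map h ≪ (volume : Measure ℝ)) {A : Set Ω}
    (hA : MeasurableSet A) (hpos : μ A ≠ 0) {f : Ω → ℝ} (hf : Integrable f μ) {δ : ℝ}
    (hδ : 0 < δ) :
    ∃ t, μ (A ∩ {ω | h ω ≤ t}) ≠ 0 ∧ ∫ ω in A ∩ {ω | h ω ≤ t}, f ω ∂μ < δ := by
  set B : ℝ → Set Ω := fun t => A ∩ {ω | h ω ≤ t} with hB
  have hBm : ∀ t, MeasurableSet (B t) := fun t => hA.inter (measurableSet_le hm measurable_const)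
  have hBmono : Monotone B := fun s t hst ω hω => ⟨hω.1, le_trans hω.2 hst⟩
  set T : Set ℝ := {t | μ (B t) ≠ 0} with hT
  have hTbdd : BddBelow T := by
    refine ⟨0, fun t ht => ?_⟩
    by_contra hneg
    refine ht ?_
    have : B t = ∅ := Set.eq_empty_of_forall_notMem fun ω hω =>
      absurd (le_trans (h0 ω) hω.2) hneg
    rw [this, measure_empty]
  have hTne : T.Nonempty := by
    by_contra hne
    rw [Set.not_nonempty_iff_eq_empty] at hne
    have hz : ∀ n : ℕ, μ (B n) = 0 := fun n => by
      by_contra hn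
      exact absurd (show (n : ℝ) ∈ T from hn) (by simp [hne])
    refine hpos (measure_mono_null (fun ω hω => ?_) (measure_iUnion_null hz))
    obtain ⟨n, hn⟩ := exists_nat_ge (h ω)
    exact Set.mem_iUnion.2 ⟨n, hω, hn⟩
  have hsucc : ∀ n : ℕ, (0 : ℝ) < 1 / ((n : ℝ) + 1) := fun n => by positivity
  have hnull : μ (B (sInf T)) = 0 := by
    have h1 : ∀ n : ℕ, μ (B (sInf T - 1 / ((n : ℝ) + 1))) = 0 := fun n => by
      by_contra hn
      exact notMem_of_lt_csInf (by linarith [hsucc n]) hTbdd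
        (show sInf T - 1 / ((n : ℝ) + 1) ∈ T from hn)
    have h2 : μ (h ⁻¹' {sInf T}) = 0 := by
      rw [← Measure.map_apply hm (measurableSet_singleton _)]
      exact hac Real.volume_singleton
    refine measure_mono_null (fun ω hω => ?_) (measure_union_null (measure_iUnion_null h1) h2)
    rcases eq_or_lt_of_le (show h ω ≤ sInf T from hω.2) with heq | hlt
    · exact Or.inr heq
    · obtain ⟨n, hn⟩ := exists_nat_one_div_lt (sub_pos.2 hlt)
      exact Or.inl (Set.mem_iUnion.2 ⟨n, hω.1, show h ω ≤ _ by linarith⟩)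
  have hanti : Antitone fun n : ℕ => B (sInf T + 1 / ((n : ℝ) + 1)) := fun m n hmn =>
    hBmono (by gcongr)
  have hinter : ⋂ n : ℕ, B (sInf T + 1 / ((n : ℝ) + 1)) = B (sInf T) := by
    refine Set.Subset.antisymm (fun ω hω => ?_)
      (Set.subset_iInter fun n => hBmono (by linarith [hsucc n]))
    rw [Set.mem_iInter] at hω
    refine ⟨(hω 0).1, ?_⟩
    change h ω ≤ sInf T
    refine le_of_forall_pos_le_add fun ε hε => ?_
    obtain ⟨n, hn⟩ := exists_nat_one_div_lt hε
    exact le_trans (hω n).2 (by linarith)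
  have hlim := tendsto_setIntegral_of_antitone (μ := μ) (f := f) (fun n => hBm _) hanti
    ⟨0, hf.integrableOn⟩
  rw [hinter, setIntegral_measure_zero _ hnull] at hlim
  obtain ⟨n, hn⟩ := (hlim.eventually_lt_const hδ).exists
  refine ⟨_, ?_, hn⟩
  obtain ⟨t, ht, htn⟩ := exists_lt_of_csInf_lt hTne
    (show sInf T < sInf T + 1 / ((n : ℝ) + 1) by linarith [hsucc n])
  exact fun hz => ht (measure_mono_null (hBmono htn.le) hz)

theorem expect_lt {ν : Measure Path} {f g : State → ℝ}
    (hf : Integrable (fun x : Path => f (x 0)) ν) (hg : Integrable (fun x : Path => g (x 0)) ν)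
    (hfg : ∀ s, f s ≤ g s) (hlt : ν {x | f (x 0) < g (x 0)} ≠ 0) :
    expect ν f < expect ν g := by
  rw [expect, expect, ← sub_pos, ← integral_sub hg hf]
  refine (integral_pos_iff_support_of_nonneg (f := fun x : Path => g (x 0) - f (x 0))
    (fun x => sub_nonneg.2 (hfg (x 0))) (hg.sub hf)).2 ?_
  refine pos_iff_ne_zero.2 (mt (measure_mono_null fun x hx => ?_) hlt)
  exact (sub_pos.2 hx).ne'

theorem IsFadingLaw.ae_gain_pos {ν : Measure Path} (hν : IsFadingLaw ν) (l : Fin 3) :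
    ∀ᵐ x ∂ν, 0 < x 0 l := by
  have hm : Measurable fun x : Path => (x 0 l : ℝ) := by fun_prop
  have h : ν.map (fun x : Path => (x 0 l : ℝ)) {0} = 0 := hν.density l Real.volume_singleton
  rw [Measure.map_apply hm (measurableSet_singleton _)] at h
  refine measure_mono_null (fun x hx => ?_) h
  have hx' : ¬ 0 < x 0 l := hx
  simpa using hx'

namespace Policy

/-- Follow the policy `π₁` on the set `A` of fading states and `π₂` elsewhere. -/
noncomputable def piecewise (A : Set State) (hA : MeasurableSet A) (π₁ π₂ : Policy) : Policy := by
  classical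
  exact
  { mode := A.piecewise π₁.mode π₂.mode
    α₁ := fun j => A.piecewise (π₁.α₁ j) (π₂.α₁ j)
    β₂ := fun j => A.piecewise (π₁.β₂ j) (π₂.β₂ j)
    α₃ := fun j => A.piecewise (π₁.α₃ j) (π₂.α₃ j)
    β₃ := fun j => A.piecewise (π₁.β₃ j) (π₂.β₃ j)
    measurable_mode := fun m => by
      have : {s | A.piecewise π₁.mode π₂.mode s = m} =
          A.ite {s | π₁.mode s = m} {s | π₂.mode s = m} := Set.piecewise_preimage A _ _ {m}
      rw [this]
      exact hA.ite (π₁.measurable_mode m) (π₂.measurable_mode m)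
    measurable_α₁ := fun j => (π₁.measurable_α₁ j).piecewise hA (π₂.measurable_α₁ j)
    measurable_β₂ := fun j => (π₁.measurable_β₂ j).piecewise hA (π₂.measurable_β₂ j)
    measurable_α₃ := fun j => (π₁.measurable_α₃ j).piecewise hA (π₂.measurable_α₃ j)
    measurable_β₃ := fun j => (π₁.measurable_β₃ j).piecewise hA (π₂.measurable_β₃ j)
    α₁_mem := fun j s => by
      by_cases h : s ∈ A
      · simpa [h] using π₁.α₁_mem j s
      · simpa [h] using π₂.α₁_mem j s
    β₂_mem := fun j s => by
      by_cases h : s ∈ A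
      · simpa [h] using π₁.β₂_mem j s
      · simpa [h] using π₂.β₂_mem j s
    α₃_mem := fun j s => by
      by_cases h : s ∈ A
      · simpa [h] using π₁.α₃_mem j s
      · simpa [h] using π₂.α₃_mem j s
    β₃_mem := fun j s => by
      by_cases h : s ∈ A
      · simpa [h] using π₁.β₃_mem j s
      · simpa [h] using π₂.β₃_mem j s
    α₁_sum := fun s => by
      by_cases h : s ∈ A
      · simpa [h] using π₁.α₁_sum s
      · simpa [h] using π₂.α₁_sum s
    β₂_sum := fun s => by
      by_cases h : s ∈ A
      · simpa [h] using π₁.β₂_sum s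
      · simpa [h] using π₂.β₂_sum s
    α₃_sum := fun s => by
      by_cases h : s ∈ A
      · simpa [h] using π₁.α₃_sum s
      · simpa [h] using π₂.α₃_sum s
    β₃_sum := fun s => by
      by_cases h : s ∈ A
      · simpa [h] using π₁.β₃_sum s
      · simpa [h] using π₂.β₃_sum s }

section Piecewise

variable {A : Set State} (hA : MeasurableSet A) (π₁ π₂ : Policy) (P₁ P₂ : ℝ) {s : State}

theorem sentRate_piecewise_of_mem (h : s ∈ A) :
    (piecewise A hA π₁ π₂).sentRate P₁ P₂ s = π₁.sentRate P₁ P₂ s := by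
  simp [sentRate, exchange₁, exchange₂, noncoop, q, C12c, C21c, Csumnc, C1dnc, C2dnc, piecewise, h]

theorem sentRate_piecewise_of_notMem (h : s ∉ A) :
    (piecewise A hA π₁ π₂).sentRate P₁ P₂ s = π₂.sentRate P₁ P₂ s := by
  simp [sentRate, exchange₁, exchange₂, noncoop, q, C12c, C21c, Csumnc, C1dnc, C2dnc, piecewise, h]

theorem receivableRate_piecewise_of_mem (h : s ∈ A) :
    (piecewise A hA π₁ π₂).receivableRate P₁ P₂ s = π₁.receivableRate P₁ P₂ s := by
  simp [receivableRate, direct₁, direct₂, service, noncoop, q, C12c, C21c, C1dc, C2dc, Csumnc,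
    Csumc, C1dnc, C2dnc, piecewise, h]

theorem receivableRate_piecewise_of_notMem (h : s ∉ A) :
    (piecewise A hA π₁ π₂).receivableRate P₁ P₂ s = π₂.receivableRate P₁ P₂ s := by
  simp [receivableRate, direct₁, direct₂, service, noncoop, q, C12c, C21c, C1dc, C2dc, Csumnc,
    Csumc, C1dnc, C2dnc, piecewise, h]

end Piecewise

/-- Broadcast without cooperation, in the modes of a given policy. -/
def noncoopBroadcast (π : Policy) : Policy where
  mode := π.mode
  α₁ := fun j _ => if j = 1 then 1 else 0
  β₂ := fun j _ => if j = 1 then 1 else 0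
  α₃ := π.α₃
  β₃ := π.β₃
  measurable_mode := π.measurable_mode
  measurable_α₁ := fun _ => measurable_const
  measurable_β₂ := fun _ => measurable_const
  measurable_α₃ := π.measurable_α₃
  measurable_β₃ := π.measurable_β₃
  α₁_mem := fun j _ => by split_ifs <;> simp
  β₂_mem := fun j _ => by split_ifs <;> simp
  α₃_mem := π.α₃_mem
  β₃_mem := π.β₃_mem
  α₁_sum := fun _ => by simp
  β₂_sum := fun _ => by simp
  α₃_sum := π.α₃_sum
  β₃_sum := π.β₃_sum

/-- Full cooperation in mode `M3`. -/
def fullCooperation : Policy where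
  mode := fun _ => .M3
  α₁ := fun j _ => if j = 0 then 1 else 0
  β₂ := fun j _ => if j = 0 then 1 else 0
  α₃ := fun j _ => if j = 0 then 1 else 0
  β₃ := fun j _ => if j = 0 then 1 else 0
  measurable_mode := fun _ => MeasurableSet.const _
  measurable_α₁ := fun _ => measurable_const
  measurable_β₂ := fun _ => measurable_const
  measurable_α₃ := fun _ => measurable_const
  measurable_β₃ := fun _ => measurable_const
  α₁_mem := fun j _ => by split_ifs <;> simp
  β₂_mem := fun j _ => by split_ifs <;> simp
  α₃_mem := fun j _ => by split_ifs <;> simp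
  β₃_mem := fun j _ => by split_ifs <;> simp
  α₁_sum := fun _ => by simp
  β₂_sum := fun _ => by simp
  α₃_sum := fun _ => by simp
  β₃_sum := fun _ => by simp

/-- Shift the fraction `θ` of the cooperative power of mode `M3` to the non-cooperative codewords. -/
noncomputable def shiftFraction (θ : ℝ) (a : Fin 3 → State → ℝ) (j : Fin 3) (s : State) : ℝ :=
  if j = 2 then a 2 s + θ * (a 0 s + a 1 s) else (1 - θ) * a j s

theorem shiftFraction_sum {θ : ℝ} {a : Fin 3 → State → ℝ} {s : State} (h : ∑ j, a j s = 1) :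
    ∑ j, shiftFraction θ a j s = 1 := by
  rw [Fin.sum_univ_three] at h ⊢
  simp [shiftFraction]
  linarith

theorem shiftFraction_mem {θ : ℝ} (hθ : θ ∈ Set.Icc (0 : ℝ) 1) {a : Fin 3 → State → ℝ} {s : State}
    (ha : ∀ j, a j s ∈ Set.Icc (0 : ℝ) 1) (h : ∑ j, a j s = 1) (j : Fin 3) :
    shiftFraction θ a j s ∈ Set.Icc (0 : ℝ) 1 := by
  have hnn : ∀ j, 0 ≤ shiftFraction θ a j s := fun j => by
    unfold shiftFraction
    split_ifs
    · exact add_nonneg (ha 2).1 (mul_nonneg hθ.1 (add_nonneg (ha 0).1 (ha 1).1))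
    · exact mul_nonneg (sub_nonneg.2 hθ.2) (ha j).1
  refine ⟨hnn j, ?_⟩
  rw [← shiftFraction_sum (θ := θ) h]
  exact Finset.single_le_sum (f := fun j => shiftFraction θ a j s) (fun j _ => hnn j)
    (Finset.mem_univ j)

theorem measurable_shiftFraction (θ : ℝ) {a : Fin 3 → State → ℝ} (ha : ∀ j, Measurable (a j))
    (j : Fin 3) : Measurable (shiftFraction θ a j) := by
  unfold shiftFraction
  have h0 := ha 0
  have h1 := ha 1
  have h2 := ha 2
  have hj := ha j
  split_ifs <;> fun_prop

/-- The policy `π` with the fraction `θ` of the cooperative power of mode `M3` shifted to the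
non-cooperative codewords. -/
noncomputable def shiftPower (π : Policy) {θ : ℝ} (hθ : θ ∈ Set.Icc (0 : ℝ) 1) : Policy where
  mode := π.mode
  α₁ := π.α₁
  β₂ := π.β₂
  α₃ := shiftFraction θ π.α₃
  β₃ := shiftFraction θ π.β₃
  measurable_mode := π.measurable_mode
  measurable_α₁ := π.measurable_α₁
  measurable_β₂ := π.measurable_β₂
  measurable_α₃ := measurable_shiftFraction θ π.measurable_α₃
  measurable_β₃ := measurable_shiftFraction θ π.measurable_β₃
  α₁_mem := π.α₁_mem
  β₂_mem := π.β₂_mem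
  α₃_mem := fun j s => shiftFraction_mem hθ (fun j => π.α₃_mem j s) (π.α₃_sum s) j
  β₃_mem := fun j s => shiftFraction_mem hθ (fun j => π.β₃_mem j s) (π.β₃_sum s) j
  α₁_sum := π.α₁_sum
  β₂_sum := π.β₂_sum
  α₃_sum := fun s => shiftFraction_sum (π.α₃_sum s)
  β₃_sum := fun s => shiftFraction_sum (π.β₃_sum s)

section Rates

variable (π : Policy) {P₁ P₂ : ℝ} {s : State}

theorem sentRate_M1 (h : π.mode s = .M1) :
    π.sentRate P₁ P₂ s = π.C12c P₁ s + π.C1dnc P₁ s := by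
  simp [sentRate, exchange₁, exchange₂, noncoop, q, h]

theorem sentRate_M2 (h : π.mode s = .M2) :
    π.sentRate P₁ P₂ s = π.C21c P₂ s + π.C2dnc P₂ s := by
  simp [sentRate, exchange₁, exchange₂, noncoop, q, h]

theorem sentRate_M3 (h : π.mode s = .M3) : π.sentRate P₁ P₂ s = π.Csumnc P₁ P₂ s := by
  simp [sentRate, exchange₁, exchange₂, noncoop, q, h]

theorem receivableRate_M1 (h : π.mode s = .M1) :
    π.receivableRate P₁ P₂ s = min (π.C12c P₁ s) (π.C1dc P₁ s) + π.C1dnc P₁ s := by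
  simp [receivableRate, direct₁, direct₂, service, noncoop, q, h]

theorem receivableRate_M2 (h : π.mode s = .M2) :
    π.receivableRate P₁ P₂ s = min (π.C21c P₂ s) (π.C2dc P₂ s) + π.C2dnc P₂ s := by
  simp [receivableRate, direct₁, direct₂, service, noncoop, q, h]

theorem receivableRate_M3 (h : π.mode s = .M3) : π.receivableRate P₁ P₂ s = π.Csumc P₁ P₂ s := by
  simp [receivableRate, direct₁, direct₂, service, noncoop, q, h]

theorem receivableRate_le_sentRate (h : π.mode s ≠ .M3) :
    π.receivableRate P₁ P₂ s ≤ π.sentRate P₁ P₂ s := by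
  cases hm : π.mode s with
  | M1 =>
    rw [π.sentRate_M1 hm, π.receivableRate_M1 hm]
    gcongr
    exact min_le_left _ _
  | M2 =>
    rw [π.sentRate_M2 hm, π.receivableRate_M2 hm]
    gcongr
    exact min_le_left _ _
  | M3 => exact absurd hm h

variable (hP₁ : 0 < P₁) (hP₂ : 0 < P₂)

include hP₁ hP₂

theorem sentRate_le_receivableRate (h : π.mode s = .M3) :
    π.sentRate P₁ P₂ s ≤ π.receivableRate P₁ P₂ s := by
  rw [π.sentRate_M3 h, π.receivableRate_M3 h]
  exact π.Csumnc_le_Csumc s hP₁ hP₂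

theorem sentRate_nonneg : 0 ≤ π.sentRate P₁ P₂ s :=
  add_nonneg (add_nonneg (π.exchange₁_nonneg s hP₁) (π.exchange₂_nonneg s hP₂))
    (π.noncoop_nonneg s hP₁ hP₂)

theorem receivableRate_nonneg : 0 ≤ π.receivableRate P₁ P₂ s :=
  add_nonneg (add_nonneg (add_nonneg (π.direct₁_nonneg s hP₁) (π.direct₂_nonneg s hP₂))
    (π.noncoop_nonneg s hP₁ hP₂)) (π.service_nonneg s hP₁ hP₂)

omit hP₂ in
theorem rates_lt_noncoopBroadcast_M1 (h : π.mode s = .M1) (hlt : π.C12c P₁ s < π.C1dc P₁ s) :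
    π.sentRate P₁ P₂ s < π.noncoopBroadcast.sentRate P₁ P₂ s ∧
      π.receivableRate P₁ P₂ s < π.noncoopBroadcast.receivableRate P₁ P₂ s := by
  have h' : π.noncoopBroadcast.mode s = .M1 := h
  have h1 : π.noncoopBroadcast.C12c P₁ s = 0 := by simp [C12c, noncoopBroadcast]
  have h2 : π.noncoopBroadcast.C1dc P₁ s = 0 := by simp [C1dc, noncoopBroadcast]
  have h3 : π.noncoopBroadcast.C1dnc P₁ s = C (P₁ * s 1) := by simp [C1dnc, noncoopBroadcast]
  rw [π.sentRate_M1 h, π.receivableRate_M1 h, sentRate_M1 _ h', receivableRate_M1 _ h', h1, h2, h3,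
    min_self, zero_add, ← π.C1dc_add_C1dnc s hP₁, min_eq_left hlt.le]
  constructor <;> linarith

omit hP₁ in
theorem rates_lt_noncoopBroadcast_M2 (h : π.mode s = .M2) (hlt : π.C21c P₂ s < π.C2dc P₂ s) :
    π.sentRate P₁ P₂ s < π.noncoopBroadcast.sentRate P₁ P₂ s ∧
      π.receivableRate P₁ P₂ s < π.noncoopBroadcast.receivableRate P₁ P₂ s := by
  have h' : π.noncoopBroadcast.mode s = .M2 := h
  have h1 : π.noncoopBroadcast.C21c P₂ s = 0 := by simp [C21c, noncoopBroadcast]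
  have h2 : π.noncoopBroadcast.C2dc P₂ s = 0 := by simp [C2dc, noncoopBroadcast]
  have h3 : π.noncoopBroadcast.C2dnc P₂ s = C (P₂ * s 2) := by simp [C2dnc, noncoopBroadcast]
  rw [π.sentRate_M2 h, π.receivableRate_M2 h, sentRate_M2 _ h', receivableRate_M2 _ h', h1, h2, h3,
    min_self, zero_add, ← π.C2dc_add_C2dnc s hP₂, min_eq_left hlt.le]
  constructor <;> linarith

omit hP₁ hP₂ in
theorem sentRate_fullCooperation : fullCooperation.sentRate P₁ P₂ s = 0 := by
  rw [sentRate_M3 _ rfl]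
  simp [Csumnc, fullCooperation]

/-- Full cooperation delivers more than a broadcast. -/
theorem receivableRate_lt_fullCooperation (h : π.mode s ≠ .M3) (h1 : 0 < s 1) (h2 : 0 < s 2) :
    π.receivableRate P₁ P₂ s < fullCooperation.receivableRate P₁ P₂ s := by
  have h1' : (0 : ℝ) < s 1 := h1
  have h2' : (0 : ℝ) < s 2 := h2
  have hs1 : 0 < P₁ * s 1 := mul_pos hP₁ h1'
  have hs2 : 0 < P₂ * s 2 := mul_pos hP₂ h2'
  have hfull : C (P₁ * s 1 + P₂ * s 2) ≤ fullCooperation.receivableRate P₁ P₂ s := by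
    rw [receivableRate_M3 _ rfl]
    exact C_le_C (by positivity) (le_add_of_nonneg_right (by positivity))
  refine lt_of_lt_of_le ?_ hfull
  cases hm : π.mode s with
  | M1 =>
    rw [π.receivableRate_M1 hm]
    calc _ ≤ π.C1dc P₁ s + π.C1dnc P₁ s := by gcongr; exact min_le_right _ _
      _ = C (P₁ * s 1) := π.C1dc_add_C1dnc s hP₁
      _ < _ := C_lt_C hs1.le (by linarith)
  | M2 =>
    rw [π.receivableRate_M2 hm]
    calc _ ≤ π.C2dc P₂ s + π.C2dnc P₂ s := by gcongr; exact min_le_right _ _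
      _ = C (P₂ * s 2) := π.C2dc_add_C2dnc s hP₂
      _ < _ := C_lt_C hs2.le (by linarith)
  | M3 => exact absurd hm h

variable {θ : ℝ} (hθ : θ ∈ Set.Icc (0 : ℝ) 1)

omit hP₁ hP₂ in
theorem snr_shiftPower : (π.shiftPower hθ).α₃ 2 s * P₁ * s 1 + (π.shiftPower hθ).β₃ 2 s * P₂ * s 2 =
    π.α₃ 2 s * P₁ * s 1 + π.β₃ 2 s * P₂ * s 2 +
      θ * ((π.α₃ 0 s + π.α₃ 1 s) * (P₁ * s 1) + (π.β₃ 0 s + π.β₃ 1 s) * (P₂ * s 2)) := by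
  simp only [shiftPower, shiftFraction, if_true]
  ring

theorem coop_power_nonneg :
    0 ≤ (π.α₃ 0 s + π.α₃ 1 s) * (P₁ * s 1) ∧ 0 ≤ (π.β₃ 0 s + π.β₃ 1 s) * (P₂ * s 2) :=
  ⟨mul_nonneg (add_nonneg (π.α₃_mem 0 s).1 (π.α₃_mem 1 s).1) (by positivity),
    mul_nonneg (add_nonneg (π.β₃_mem 0 s).1 (π.β₃_mem 1 s).1) (by positivity)⟩

theorem sentRate_le_shiftPower : π.sentRate P₁ P₂ s ≤ (π.shiftPower hθ).sentRate P₁ P₂ s := by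
  cases hm : π.mode s with
  | M1 =>
    rw [sentRate_M1 _ hm, sentRate_M1 (π.shiftPower hθ) hm]
    exact le_rfl
  | M2 =>
    rw [sentRate_M2 _ hm, sentRate_M2 (π.shiftPower hθ) hm]
    exact le_rfl
  | M3 =>
    rw [sentRate_M3 _ hm, sentRate_M3 (π.shiftPower hθ) hm]
    refine C_le_C (π.snr_sum_nc_mem s hP₁ hP₂).1 ?_
    rw [π.snr_shiftPower hθ]
    have h := π.coop_power_nonneg hP₁ hP₂ (s := s)
    exact le_add_of_nonneg_right (mul_nonneg hθ.1 (add_nonneg h.1 h.2))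

theorem sentRate_lt_shiftPower (hθ0 : 0 < θ)
    (hlt : π.sentRate P₁ P₂ s < π.receivableRate P₁ P₂ s) :
    π.sentRate P₁ P₂ s < (π.shiftPower hθ).sentRate P₁ P₂ s := by
  have hm : π.mode s = .M3 := by
    by_contra h
    exact absurd hlt (π.receivableRate_le_sentRate h).not_gt
  rw [π.sentRate_M3 hm, π.receivableRate_M3 hm] at hlt
  rw [sentRate_M3 _ hm, sentRate_M3 (π.shiftPower hθ) hm]
  refine C_lt_C (π.snr_sum_nc_mem s hP₁ hP₂).1 ?_
  rw [π.snr_shiftPower hθ]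
  obtain ⟨h1, h2⟩ := π.coop_power_nonneg hP₁ hP₂ (s := s)
  refine lt_add_of_pos_right _ (mul_pos hθ0 ?_)
  by_contra hcon
  have h3 : (π.α₃ 0 s + π.α₃ 1 s) * (P₁ * s 1) = 0 := by linarith
  have h4 : (π.β₃ 0 s + π.β₃ 1 s) * (P₂ * s 2) = 0 := by linarith
  refine hlt.ne ?_
  unfold Csumnc Csumc
  rw [show (π.α₃ 0 s + π.α₃ 1 s) * (π.β₃ 0 s + π.β₃ 1 s) * P₁ * P₂ * s 1 * s 2 =
    ((π.α₃ 0 s + π.α₃ 1 s) * (P₁ * s 1)) * ((π.β₃ 0 s + π.β₃ 1 s) * (P₂ * s 2)) by ring, h3,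
    zero_mul, Real.sqrt_zero]
  rw [α₃_add] at h3
  rw [β₃_add] at h4
  congr 1
  linarith

theorem mul_receivableRate_le_shiftPower :
    (1 - θ) * π.receivableRate P₁ P₂ s ≤ (π.shiftPower hθ).receivableRate P₁ P₂ s := by
  have h0 := π.receivableRate_nonneg hP₁ hP₂ (s := s)
  have h1 : (1 - θ) * π.receivableRate P₁ P₂ s ≤ π.receivableRate P₁ P₂ s :=
    mul_le_of_le_one_left h0 (by linarith [hθ.1])
  cases hm : π.mode s with
  | M1 =>
    refine h1.trans ?_
    rw [receivableRate_M1 _ hm, receivableRate_M1 (π.shiftPower hθ) hm]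
    exact le_rfl
  | M2 =>
    refine h1.trans ?_
    rw [receivableRate_M2 _ hm, receivableRate_M2 (π.shiftPower hθ) hm]
    exact le_rfl
  | M3 =>
    rw [receivableRate_M3 _ hm, receivableRate_M3 (π.shiftPower hθ) hm]
    have hθ1 : 0 ≤ 1 - θ := sub_nonneg.2 hθ.2
    refine (mul_C_le hθ1 (by linarith [hθ.1]) (π.snrSum_mem s hP₁ hP₂).1).trans ?_
    refine C_le_C (mul_nonneg hθ1 (π.snrSum_mem s hP₁ hP₂).1) ?_
    have hsq : Real.sqrt (((π.shiftPower hθ).α₃ 0 s + (π.shiftPower hθ).α₃ 1 s) *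
        ((π.shiftPower hθ).β₃ 0 s + (π.shiftPower hθ).β₃ 1 s) * P₁ * P₂ * s 1 * s 2) =
        (1 - θ) * Real.sqrt ((π.α₃ 0 s + π.α₃ 1 s) * (π.β₃ 0 s + π.β₃ 1 s) *
          P₁ * P₂ * s 1 * s 2) := by
      rw [← Real.sqrt_sq hθ1, ← Real.sqrt_mul (sq_nonneg _)]
      congr 1
      simp [shiftPower, shiftFraction]
      ring
    rw [hsq, snrSum]
    have hg : 0 ≤ P₁ * s 1 + P₂ * s 2 := by positivity
    nlinarith [mul_nonneg hθ.1 hg]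

end Rates

end Policy

/-! ### The optimal queue condition -/

namespace Policy

/-- The largest sum rate that the protocols with a given policy achieve. -/
noncomputable def maxRate (π : Policy) (P₁ P₂ : ℝ) (ν : Measure Path) : ℝ :=
  min (expect ν (π.sentRate P₁ P₂)) (expect ν (π.receivableRate P₁ P₂))

variable {π : Policy} {P₁ P₂ : ℝ} (hP₁ : 0 < P₁) (hP₂ : 0 < P₂) {ν : Measure Path}
  (hν : IsFadingLaw ν) (hmax : ∀ π' : Policy, π'.maxRate P₁ P₂ ν ≤ π.maxRate P₁ P₂ ν)

include hP₁ hP₂ hν hmax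

theorem directLeExchange_of_maximal : π.DirectLeExchange P₁ P₂ ν := by
  set A : Set State := ({s | π.mode s = .M1} ∩ {s | π.C12c P₁ s < π.C1dc P₁ s}) ∪
    ({s | π.mode s = .M2} ∩ {s | π.C21c P₂ s < π.C2dc P₂ s}) with hAdef
  have hA : MeasurableSet A :=
    ((π.measurable_mode _).inter (measurableSet_lt π.measurable_C12c π.measurable_C1dc)).union
      ((π.measurable_mode _).inter (measurableSet_lt π.measurable_C21c π.measurable_C2dc))
  by_contra hcon
  have hpos : ν {x | x 0 ∈ A} ≠ 0 := fun hz => hcon <| by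
    have hz' : ∀ᵐ x ∂ν, ¬ x 0 ∈ A := by
      rw [ae_iff]
      simpa only [not_not] using hz
    filter_upwards [hz'] with x hx
    exact ⟨fun hm => not_lt.1 fun hlt => hx (Or.inl ⟨hm, hlt⟩),
      fun hm => not_lt.1 fun hlt => hx (Or.inr ⟨hm, hlt⟩)⟩
  set π' := piecewise A hA π.noncoopBroadcast π with hπ'
  have hlt : ∀ s ∈ A, π.sentRate P₁ P₂ s < π'.sentRate P₁ P₂ s ∧
      π.receivableRate P₁ P₂ s < π'.receivableRate P₁ P₂ s := fun s hs => by
    rw [hπ', sentRate_piecewise_of_mem hA _ _ _ _ hs, receivableRate_piecewise_of_mem hA _ _ _ _ hs]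
    rcases hs with hs | hs
    · exact π.rates_lt_noncoopBroadcast_M1 hP₁ hs.1 hs.2
    · exact π.rates_lt_noncoopBroadcast_M2 hP₂ hs.1 hs.2
  have hsent : expect ν (π.sentRate P₁ P₂) < expect ν (π'.sentRate P₁ P₂) := by
    refine expect_lt (π.integrable_sentRate hP₁ hP₂ hν) (π'.integrable_sentRate hP₁ hP₂ hν)
      (fun s => ?_) fun hz => hpos (measure_mono_null (fun x hx => (hlt _ hx).1) hz)
    by_cases hs : s ∈ A
    · exact (hlt s hs).1.le
    · rw [hπ', sentRate_piecewise_of_notMem hA _ _ _ _ hs]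
  have hrec : expect ν (π.receivableRate P₁ P₂) < expect ν (π'.receivableRate P₁ P₂) := by
    refine expect_lt (π.integrable_receivableRate hP₁ hP₂ hν)
      (π'.integrable_receivableRate hP₁ hP₂ hν)
      (fun s => ?_) fun hz => hpos (measure_mono_null (fun x hx => (hlt _ hx).2) hz)
    by_cases hs : s ∈ A
    · exact (hlt s hs).2.le
    · rw [hπ', receivableRate_piecewise_of_notMem hA _ _ _ _ hs]
  exact absurd (hmax π') (min_lt_min hsent hrec).not_ge

theorem receivableRate_le_sentRate_of_maximal :
    expect ν (π.receivableRate P₁ P₂) ≤ expect ν (π.sentRate P₁ P₂) := by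
  by_contra! hlt
  have hi := π.integrable_sentRate hP₁ hP₂ hν
  have hi' := π.integrable_receivableRate hP₁ hP₂ hν
  have hU : 0 ≤ expect ν (π.sentRate P₁ P₂) :=
    integral_nonneg fun x => π.sentRate_nonneg hP₁ hP₂ (s := x 0)
  set U := expect ν (π.sentRate P₁ P₂) with hUdef
  set V := expect ν (π.receivableRate P₁ P₂) with hVdef
  have hV : 0 < V := hU.trans_lt hlt
  have hθ0 : 0 < (V - U) / (2 * V) := div_pos (sub_pos.2 hlt) (by positivity)
  have hθ : (V - U) / (2 * V) ∈ Set.Icc (0 : ℝ) 1 :=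
    ⟨hθ0.le, (div_le_one (by positivity)).2 (by linarith)⟩
  set π' := π.shiftPower hθ with hπ'
  have hsent : U < expect ν (π'.sentRate P₁ P₂) := by
    refine expect_lt hi (π'.integrable_sentRate hP₁ hP₂ hν)
      (fun s => π.sentRate_le_shiftPower hP₁ hP₂ hθ) fun hz => hlt.not_ge ?_
    have hz' : ∀ᵐ x ∂ν, ¬ π.sentRate P₁ P₂ (x 0) < π'.sentRate P₁ P₂ (x 0) := by
      rw [ae_iff]
      simpa only [not_not] using hz
    refine integral_mono_ae hi' hi ?_
    filter_upwards [hz'] with x hx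
    exact not_lt.1 fun h => hx (π.sentRate_lt_shiftPower hP₁ hP₂ hθ hθ0 h)
  have hrec : U < expect ν (π'.receivableRate P₁ P₂) := by
    have h1 : (1 - (V - U) / (2 * V)) * V ≤ expect ν (π'.receivableRate P₁ P₂) := by
      rw [hVdef, expect, ← integral_const_mul]
      exact integral_mono (hi'.const_mul _) (π'.integrable_receivableRate hP₁ hP₂ hν)
        fun x => π.mul_receivableRate_le_shiftPower hP₁ hP₂ hθ
    have h2 : (1 - (V - U) / (2 * V)) * V = (V + U) / 2 := by
      field_simp
      ring
    linarith
  have := hmax π'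
  exact absurd this (lt_of_le_of_lt (min_le_left _ _) (lt_min hsent hrec)).not_ge

theorem sentRate_le_receivableRate_of_maximal :
    expect ν (π.sentRate P₁ P₂) ≤ expect ν (π.receivableRate P₁ P₂) := by
  have := hν.isProbabilityMeasure
  by_contra! hlt
  have hi := π.integrable_sentRate hP₁ hP₂ hν
  have hi' := π.integrable_receivableRate hP₁ hP₂ hν
  set S : Set State := {s | π.receivableRate P₁ P₂ s < π.sentRate P₁ P₂ s} ∩
    ({s | 0 < s 1} ∩ {s | 0 < s 2}) with hS
  have hSm : MeasurableSet S :=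
    (measurableSet_lt π.measurable_receivableRate π.measurable_sentRate).inter
      ((measurableSet_lt measurable_const (measurable_pi_apply 1)).inter
        (measurableSet_lt measurable_const (measurable_pi_apply 2)))
  have hpos : ν {x | x 0 ∈ S} ≠ 0 := fun hz => hlt.not_ge <| by
    have hz' : ∀ᵐ x ∂ν, ¬ x 0 ∈ S := by
      rw [ae_iff]
      simpa only [not_not] using hz
    refine integral_mono_ae hi hi' ?_
    filter_upwards [hz', hν.ae_gain_pos 1, hν.ae_gain_pos 2] with x hx h1 h2
    exact not_lt.1 fun h => hx ⟨h, h1, h2⟩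
  have hm1 : Measurable fun x : Path => (x 0 1 : ℝ) := by fun_prop
  have heval : Measurable fun x : Path => x 0 := measurable_pi_apply 0
  obtain ⟨t, ht, hloss⟩ := exists_setIntegral_lt hm1 (fun x => (x 0 1).2) (hν.density 1)
    (heval hSm) hpos hi (sub_pos.2 hlt)
  set E : Set State := S ∩ {s | (s 1 : ℝ) ≤ t} with hE
  have hEm : MeasurableSet E := hSm.inter
    (measurableSet_le (measurable_pi_apply 1).coe_nnreal_real measurable_const)
  set B : Set Path := {x | x 0 ∈ E} with hB
  have hBm : MeasurableSet B := heval hEm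
  have hBpos : ν B ≠ 0 := ht
  have hBloss : ∫ x in B, π.sentRate P₁ P₂ (x 0) ∂ν <
    expect ν (π.sentRate P₁ P₂) - expect ν (π.receivableRate P₁ P₂) := hloss
  set π' := piecewise E hEm fullCooperation π with hπ'
  have hsent : expect ν (π.receivableRate P₁ P₂) < expect ν (π'.sentRate P₁ P₂) := by
    have h1 : expect ν (π.sentRate P₁ P₂) - ∫ x in B, π.sentRate P₁ P₂ (x 0) ∂ν =
        expect ν (π'.sentRate P₁ P₂) := by
      rw [← integral_indicator hBm, expect, ← integral_sub hi (hi.indicator hBm)]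
      refine integral_congr_ae (Eventually.of_forall fun x => ?_)
      by_cases hx : x ∈ B
      · simp only [Set.indicator_of_mem hx, sub_self]
        rw [hπ', sentRate_piecewise_of_mem hEm _ _ _ _ hx, sentRate_fullCooperation]
      · simp only [Set.indicator_of_notMem hx, sub_zero]
        rw [hπ', sentRate_piecewise_of_notMem hEm _ _ _ _ hx]
    linarith
  have hElt : ∀ s ∈ E, π.receivableRate P₁ P₂ s < π'.receivableRate P₁ P₂ s := fun s hs => by
    rw [hπ', receivableRate_piecewise_of_mem hEm _ _ _ _ hs]
    refine π.receivableRate_lt_fullCooperation hP₁ hP₂ (fun hm => ?_) hs.1.2.1 hs.1.2.2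
    exact absurd hs.1.1 (π.sentRate_le_receivableRate hP₁ hP₂ hm).not_gt
  have hrec : expect ν (π.receivableRate P₁ P₂) < expect ν (π'.receivableRate P₁ P₂) := by
    refine expect_lt hi' (π'.integrable_receivableRate hP₁ hP₂ hν)
      (fun s => ?_) fun hz => hBpos (measure_mono_null (fun x hx => hElt _ hx) hz)
    by_cases hs : s ∈ E
    · exact (hElt s hs).le
    · rw [hπ', receivableRate_piecewise_of_notMem hEm _ _ _ _ hs]
  exact absurd (hmax π') (lt_of_le_of_lt (min_le_right _ _) (lt_min hsent hrec)).not_ge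

end Policy

theorem Protocol.IsOptimal.queueCondition {P₁ P₂ : ℝ} (hP₁ : 0 < P₁) (hP₂ : 0 < P₂)
    {ν : Measure Path} (hν : IsFadingLaw ν) {σ : Protocol P₁ P₂} (hσ : σ.IsOptimal ν) :
    σ.policy.QueueBalance P₁ P₂ ν ∧ σ.RateStable ν ∧
      σ.HasCoopRate ν (σ.policy.avgC12c P₁ ν + σ.policy.avgC21c P₂ ν) ∧
      σ.HasNoncoopRate ν
        (σ.policy.avgCsumnc P₁ P₂ ν + σ.policy.avgC1dnc P₁ ν + σ.policy.avgC2dnc P₂ ν) := by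
  obtain ⟨R, hR, hbest⟩ := hσ
  have hle : ∀ π' : Policy, π'.maxRate P₁ P₂ ν ≤ R := fun π' => by
    obtain ⟨σ', hσ'⟩ := π'.exists_hasSumRate hP₁ hP₂ hν
    exact hbest σ' _ hσ'
  have hRle : R ≤ σ.policy.maxRate P₁ P₂ ν :=
    le_min (HasSumRate.le_sentRate σ hP₁ hP₂ hν hR) (HasSumRate.le_receivableRate σ hP₁ hP₂ hν hR)
  have hmax : ∀ π' : Policy, π'.maxRate P₁ P₂ ν ≤ σ.policy.maxRate P₁ P₂ ν := fun π' =>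
    (hle π').trans hRle
  have heq : expect ν (σ.policy.sentRate P₁ P₂) = expect ν (σ.policy.receivableRate P₁ P₂) :=
    le_antisymm (Policy.sentRate_le_receivableRate_of_maximal hP₁ hP₂ hν hmax)
      (Policy.receivableRate_le_sentRate_of_maximal hP₁ hP₂ hν hmax)
  refine ⟨(σ.policy.queueBalance_iff hP₁ hP₂ hν
    (Policy.directLeExchange_of_maximal hP₁ hP₂ hν hmax)).2 heq, ?_⟩
  refine HasSumRate.rates_of_eq_sentRate σ hP₁ hP₂ hν ?_
  have hRU : R = expect ν (σ.policy.sentRate P₁ P₂) := by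
    rw [le_antisymm hRle (hle _), Policy.maxRate, ← heq, min_self]
  exact hRU ▸ hR

theorem Policy.exists_protocol_of_queueBalance {P₁ P₂ : ℝ} (hP₁ : 0 < P₁) (hP₂ : 0 < P₂)
    {ν : Measure Path} (hν : IsFadingLaw ν) {π : Policy} (hbal : π.QueueBalance P₁ P₂ ν)
    (hdir : π.DirectLeExchange P₁ P₂ ν) :
    ∃ σ : Protocol P₁ P₂, σ.policy = π ∧ σ.RateStable ν ∧
      σ.HasCoopRate ν (π.avgC12c P₁ ν + π.avgC21c P₂ ν) ∧
      σ.HasNoncoopRate ν (π.avgCsumnc P₁ P₂ ν + π.avgC1dnc P₁ ν + π.avgC2dnc P₂ ν) := by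
  have hθ : (1 : ℝ) ∈ Set.Icc (0 : ℝ) 1 := ⟨zero_le_one, le_rfl⟩
  have heq := (π.queueBalance_iff hP₁ hP₂ hν hdir).1 hbal
  rw [π.expect_sentRate hP₁ hP₂ hν, π.expect_receivableRate hP₁ hP₂ hν] at heq
  have hstable : 1 * (expect ν (π.exchange₁ P₁) - expect ν (π.direct₁ P₁) +
      (expect ν (π.exchange₂ P₂) - expect ν (π.direct₂ P₂))) ≤ expect ν (π.service P₁ P₂) := by
    linarith
  refine ⟨π.greedy hP₁ hP₂ hθ, rfl, π.greedy_rateStable hP₁ hP₂ hθ hν hstable, ?_, ?_⟩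
  · have h := π.greedy_hasCoopRate hP₁ hP₂ hθ hν hstable
    rwa [one_mul, one_mul, add_sub_cancel, add_sub_cancel] at h
  · rw [← π.expect_noncoop hP₁ hP₂ hν]
    exact π.greedy_hasNoncoopRate hP₁ hP₂ hθ hν

end Backhaul

theorem lemma1 (P₁ P₂ : ℝ) (hP₁ : 0 < P₁) (hP₂ : 0 < P₂)
    (ν : MeasureTheory.Measure Backhaul.Path) (hν : Backhaul.IsFadingLaw ν) :
    (∀ σ : Backhaul.Protocol P₁ P₂, σ.IsOptimal ν →
      σ.policy.QueueBalance P₁ P₂ ν ∧ σ.RateStable ν ∧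
      σ.HasCoopRate ν (σ.policy.avgC12c P₁ ν + σ.policy.avgC21c P₂ ν) ∧
      σ.HasNoncoopRate ν
        (σ.policy.avgCsumnc P₁ P₂ ν + σ.policy.avgC1dnc P₁ ν + σ.policy.avgC2dnc P₂ ν)) ∧
    (∀ π : Backhaul.Policy, π.QueueBalance P₁ P₂ ν → π.DirectLeExchange P₁ P₂ ν →
      (∃ σ : Backhaul.Protocol P₁ P₂, σ.policy = π ∧ σ.RateStable ν ∧
        σ.HasCoopRate ν (π.avgC12c P₁ ν + π.avgC21c P₂ ν) ∧
        σ.HasNoncoopRate ν (π.avgCsumnc P₁ P₂ ν + π.avgC1dnc P₁ ν + π.avgC2dnc P₂ ν)) ∧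
      (∀ σ : Backhaul.Protocol P₁ P₂, σ.policy = π → ∀ R,
        (σ.HasCoopRate ν R → R ≤ π.avgC12c P₁ ν + π.avgC21c P₂ ν) ∧
        (σ.HasNoncoopRate ν R →
          R ≤ π.avgCsumnc P₁ P₂ ν + π.avgC1dnc P₁ ν + π.avgC2dnc P₂ ν))) := by
  refine ⟨fun σ hσ => hσ.queueCondition hP₁ hP₂ hν, fun π hbal hdir =>
    ⟨Backhaul.Policy.exists_protocol_of_queueBalance hP₁ hP₂ hν hbal hdir, ?_⟩⟩
  rintro σ rfl R
  exact ⟨Backhaul.Protocol.HasCoopRate.le σ hP₁ hP₂ hν,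
    Backhaul.Protocol.HasNoncoopRate.le σ hP₁ hP₂ hν⟩
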